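/- **Setting.** An instance of the unrooted repairman problem consists of $n\ge 1$ service requests, each with a location in a network with (shortest-path) travel distances and a half-open time window $[w,e)$ with $1\le e-w\le 2$. A service run at speed $v$ starts at any request at any time, services requests inside their windows, and travels at speed at most $v$; its profit is the number of requests it services. For a period length $\alpha$ and a starting point $\tau$, the periods are the intervals $[\tau+k\alpha,\tau+(k+1)\alpha)$, $k\in\mathbb Z$. A window that opens exactly on a period boundary is treated as opening just after it, and $W_\ell$ is the set of windows that completely contain exactly $\ell$ periods. Let $\mathcal A$ be a repairman algorithm for trimmed windows on the network: on every instance of $n$ requests in which every window is one of the periods of a common set of periods, or has vanished, and for every speed $v>0$, it finds in at most $\Gamma(n)$ steps a service run at speed $v$ whose profit is at least $1/\gamma$ times the maximum profit of a service run at speed $v$ for that instance; assume $\Gamma(n)\ge n$. *SPEEDUP* (speed $s$, period length $\alpha$, starting point $\tau$, choices $j,k$): for each set of periods of length $\alpha$ with starting point $\tau+t$, where $t$ runs over the offsets below, trim every window in $W_1$ to its first full period, in $W_2$ to its $j$-th, in $W_3$ to its $k$-th (any other window vanishes), run $\mathcal A$ at speed $s$, and retain the best run. For $s=q/r$ with positive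 integers $q,r$ (both doubled if $q+r$ is odd), the offsets are $0,\alpha/r,\dots,(r-1)\alpha/r$, unless the numbers $w-\tau$ and $e-\tau$, over all windows $[w,e)$, have at most $r$ different residues modulo $\alpha$, in which case the offsets are these residues. For $s$ given only as a real number the offsets are always these residues. *SPEEDUPW12* runs SPEEDUP with $\alpha=\frac12$, $\tau\in\{0,\frac14\}$, $j\in\{1,2\}$, $k\in\{1,2,3\}$; with $\alpha=\frac34$, $\tau\in\{0,\frac14,\frac12\}$, $j\in\{1,2\}$; and with $\alpha=1$, $\tau\in\{0,\frac14,\frac12,\frac34\}$; it retains the best run. Let $m$ be the number of different sets of periods of length $\frac12$ for the instance, that is, the number of residues modulo $\frac12$ of the endpoints of the windows. **Theorem.** Let $2\le s\le 7/3$, and let all windows of the instance be in $W_3$ for period length $\frac12$ and some starting point. Then SPEEDUPW12 finds a $6\gamma/s$-approximation: it returns a service run $\hat R$ at speed $s$ with $$\mathrm{profit}(R^*)\le \frac{6\gamma}{s}\,\mathrm{profit}(\hat R)$$ for every service run $R^*$ at unit speed, in particular for an optimal one. If $s=q/r$ with positive integers $q,r$, it does so in $O(\min\{r,m\}\,\Gamma(n))$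 steps; if $s$ is an arbitrary real number, in $O(m\,\Gamma(n))$ steps. The implied constants are absolute. -/

import Mathlib

/-! ## The repairman problem -/

/-- A service request: a location in the network and the half-open time window
`[opening, closing)` in which it may be serviced. -/
structure Request (V : Type*) where
  loc : V
  opening : ℝ
  closing : ℝ

/-- An instance with `n` service requests in the network `V` (with its travel distances). -/
abbrev Instance (V : Type*) (n : ℕ) := Fin n → Request V

/-- A service run: the serviced requests, in the order of service, with the service times. -/
abbrev Run (n : ℕ) := List (Fin n × ℝ)

/-- `R` is a service run at speed `s` for `I`: every listed request is serviced once and inside its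
window, services are listed in order of time, and the distance between the locations of two services
can be travelled at speed `s` in the time between them. The start is free. -/
structure IsServiceRun {V : Type*} [PseudoMetricSpace V] {n : ℕ} (s : ℝ) (I : Instance V n)
    (R : Run n) : Prop where
  nodup : (R.map Prod.fst).Nodup
  inWindow : ∀ p ∈ R, p.2 ∈ Set.Ico (I p.1).opening (I p.1).closing
  travel : R.Pairwise fun a b =>
    a.2 ≤ b.2 ∧ dist (I a.1).loc (I b.1).loc ≤ s * (b.2 - a.2)

/-- The profit of a run is the number of requests it services. -/
def profit {n : ℕ} (R : Run n) : ℕ := R.length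

/-! ## Periods -/

/-- The numbers `k` of the periods `[τ + kα, τ + (k+1)α)` (length `α`, starting point `τ`) that the
window of `q` contains completely. A window that opens exactly at the start of a period counts as
opening just after it, so that no window starts on a period boundary. -/
def fullPeriods {V : Type*} (τ α : ℝ) (q : Request V) : Set ℤ :=
  {k | q.opening < τ + k * α ∧ τ + (k + 1) * α ≤ q.closing}

/-- The window of `q` is in the set `W_ℓ`: it completely contains exactly `ℓ` periods. -/
def InW {V : Type*} (ℓ : ℕ) (τ α : ℝ) (q : Request V) : Prop :=
  (fullPeriods τ α q).encard = ℓ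

/-- Every window of `I` is one of the periods of length `α` with starting point `τ`,
or has vanished (is empty). -/
def TrimmedTo {V : Type*} {n : ℕ} (τ α : ℝ) (I : Instance V n) : Prop :=
  ∀ i, (I i).closing ≤ (I i).opening ∨
    ∃ k : ℤ, (I i).opening = τ + k * α ∧ (I i).closing = τ + (k + 1) * α

/-- The number `m` of different sets of periods of length `1/2`. When the starting point moves, the
way in which windows contain and overlap periods changes only when a period boundary passes an
endpoint of a window, so this is the number of residues modulo `1/2` of the window endpoints. -/
noncomputable def numPeriodSets {V : Type*} {n : ℕ} (I : Instance V n) : ℕ :=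
  ((Finset.univ.image fun i => Int.fract (2 * (I i).opening)) ∪
    (Finset.univ.image fun i => Int.fract (2 * (I i).closing))).card

/-! ## Step counting

Algorithms are programs in a monad that counts elementary steps of a real RAM. -/

/-- A computation: its result and the number of steps it takes. -/
structure Timed (β : Type) where
  val : β
  steps : ℕ

namespace Timed

instance : Monad Timed where
  pure a := ⟨a, 0⟩
  bind x f := ⟨(f x.val).val, x.steps + (f x.val).steps⟩

/-- One elementary operation (arithmetic operation, floor, or comparison) with result `a`. -/
def op {β : Type} (a : β) : Timed β := ⟨a, 1⟩

/-- A loop that fills an array of length `n`; one step per iteration besides the body. -/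
def tabulate {β : Type} {n : ℕ} (f : Fin n → Timed β) : Timed (Fin n → β) :=
  ⟨fun i => (f i).val, ∑ i, ((f i).steps + 1)⟩

/-- A loop over a list; one step per iteration besides the body. -/
def mapList {β δ : Type} (f : β → Timed δ) : List β → Timed (List δ)
  | [] => op []
  | x :: xs => do
      let _ ← op ()
      let y ← f x
      let ys ← mapList f xs
      return y :: ys

end Timed

open Timed in
/-- Membership in a list of reals by linear search. -/
noncomputable def searchList (x : ℝ) : List ℝ → Timed Bool
  | [] => op false
  | y :: ys => do
      let b ← op (decide (x = y))
      if b then return true else searchList x ys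

/-! ## The subroutine for trimmed windows -/

/-- A repairman algorithm for trimmed windows on the network `V`: from a speed and an instance it
computes a run. -/
abbrev TrimmedSolver (V : Type*) := ∀ n : ℕ, ℝ → Instance V n → Timed (Run n)

/-- The meaning of the parameters `γ` and `Γ`: on every instance of `n` requests whose windows are
trimmed to periods, at every speed `s`, the algorithm finds a service run at speed `s` within a
factor `γ` of the best service run at speed `s` for that instance, in at most `Γ n` steps. -/
def HasGuarantee {V : Type*} [PseudoMetricSpace V] (A : TrimmedSolver V) (γ : ℝ) (Γ : ℕ → ℕ) :
    Prop :=
  ∀ (n : ℕ) (s τ α : ℝ) (J : Instance V n), 0 < s → 0 < α → TrimmedTo τ α J →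
    IsServiceRun s J (A n s J).val ∧
    (∀ R : Run n, IsServiceRun s J R → (profit R : ℝ) ≤ γ * profit (A n s J).val) ∧
    (A n s J).steps ≤ Γ n

/-! ## The algorithm SPEEDUPW12 -/

open Timed in
/-- Which of its `ℓ` full periods a window is trimmed to: the first if `ℓ = 1`, the `j`-th if
`ℓ = 2`, the `k`-th if `ℓ = 3`; otherwise the window vanishes. -/
def choosePeriod (j k : ℕ) (ℓ : ℤ) : Timed (Option ℕ) := do
  let b₁ ← op (decide (ℓ = 1))
  if b₁ then return some 1
  else
    let b₂ ← op (decide (ℓ = 2))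
    if b₂ then return some j
    else
      let b₃ ← op (decide (ℓ = 3))
      if b₃ then return some k else return none

open Timed in
/-- The endpoints of the window `[w, e)` after trimming for the periods of length `α` with starting
point `τ`; the full periods in the window are numbered from `first` to `last - 1`. A window that
vanishes becomes the empty interval `[0, 0)`. -/
noncomputable def trimWindow (τ α : ℝ) (j k : ℕ) (w e : ℝ) : Timed (ℝ × ℝ) := do
  let x ← op (w - τ)
  let x ← op (x / α)
  let f ← op ⌊x⌋
  let first ← op (f + 1)
  let y ← op (e - τ)
  let y ← op (y / α)
  let last ← op ⌊y⌋
  let ℓ ← op (last - first)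
  let choice ← choosePeriod j k ℓ
  match choice with
  | none => return (0, 0)
  | some c =>
      let a ← op (first + (c : ℤ))
      let a ← op (a - 1)
      let u ← op ((a : ℝ) * α)
      let u ← op (τ + u)
      let v ← op (u + α)
      return (u, v)

/-- The instance with the same locations as `I` and the windows `[(W i).1, (W i).2)`. -/
def withWindows {V : Type*} {n : ℕ} (I : Instance V n) (W : Fin n → ℝ × ℝ) : Instance V n :=
  fun i => ⟨(I i).loc, (W i).1, (W i).2⟩

open Timed in
/-- The more profitable of two runs; both are traversed. -/
def better {n : ℕ} (R R' : Run n) : Timed (Run n) :=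
  ⟨if profit R < profit R' then R' else R, profit R + profit R' + 1⟩

/-- Carry out the given computations one after another and retain the best run,
starting from the run `R`. -/
def retainBest {n : ℕ} (R : Run n) : List (Timed (Run n)) → Timed (Run n)
  | [] => Timed.op R
  | c :: cs => do
      let R' ← c
      let R'' ← better R R'
      retainBest R'' cs

open Timed in
/-- The residue of `x - τ` modulo `α`. -/
noncomputable def residue (τ α x : ℝ) : Timed ℝ := do
  let x ← op (x - τ)
  let y ← op (x / α)
  let f ← op ⌊y⌋
  let z ← op ((f : ℝ) * α)
  op (x - z)

open Timed in
/-- Add the elements of a list to the list `acc` of `c` different reals without repetition. If there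
is a bound `g` and more than `g` different reals are met, give up at once with result `none`. -/
noncomputable def collect (g : Option ℕ) : List ℝ → List ℝ → ℕ → Timed (Option (List ℝ))
  | [], acc, _ => op (some acc)
  | x :: xs, acc, c => do
      let old ← searchList x acc
      if old then collect g xs acc c
      else
        let c' ← op (c + 1)
        let full ← op (g.any fun b => decide (b < c'))
        if full then return none else collect g xs (x :: acc) c'

open Timed in
/-- The offsets, relative to `τ`, of the sets of periods of length `α` that are tried. If the window
endpoints have more than `g` residues modulo `α`, these are the `g` multiples `0, α/g, 2α/g, …` of a
hop; otherwise (or if there is no bound `g`) they are the residues, one offset for every different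
set of periods. -/
noncomputable def offsets {V : Type*} {n : ℕ} (g : Option ℕ) (τ α : ℝ) (I : Instance V n) :
    Timed (List ℝ) := do
  let opens ← mapList (fun i => residue τ α (I i).opening) (List.finRange n)
  let closes ← mapList (fun i => residue τ α (I i).closing) (List.finRange n)
  let c ← collect g (opens ++ closes) [] 0
  match c, g with
  | some l, _ => return l
  | none, none => return []
  | none, some b =>
      mapList (fun a : ℕ => do
        let x ← op ((a : ℝ) * α)
        op (x / (b : ℝ))) (List.range b)

open Timed in
/-- SPEEDUP at speed `s`, with period length `α`, starting point `τ` and the choice `(j, k)` of the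
full period that is kept: for each of the sets of periods, trim the windows and run the algorithm
`A` for trimmed windows; retain the best run. -/
noncomputable def speedup {V : Type*} {n : ℕ} (A : TrimmedSolver V) (s : ℝ) (g : Option ℕ)
    (τ α : ℝ) (j k : ℕ) (I : Instance V n) : Timed (Run n) := do
  let ts ← offsets g τ α I
  retainBest [] (ts.map fun t => do
    let τ' ← op (τ + t)
    let W ← tabulate fun i => trimWindow τ' α j k (I i).opening (I i).closing
    A n s (withWindows I W))

/-- SPEEDUPW12 at speed `s`. The three phases use period lengths `1/2`, `3/4` and `1`, with starting
points `i/4`; in the second and third phase there are no windows in `W_3`, respectively in `W_2`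
or `W_3`. -/
noncomputable def speedupW12 {V : Type*} {n : ℕ} (A : TrimmedSolver V) (s : ℝ) (g : Option ℕ)
    (I : Instance V n) : Timed (Run n) :=
  retainBest []
    (((List.range 2).flatMap fun i => [1, 2].flatMap fun j => [1, 2, 3].map fun k =>
        speedup A s g ((i : ℝ) / 4) (1 / 2) j k I) ++
      ((List.range 3).flatMap fun i => [1, 2].map fun j =>
        speedup A s g ((i : ℝ) / 4) (3 / 4) j 1 I) ++
      ((List.range 4).map fun i =>
        speedup A s g ((i : ℝ) / 4) 1 1 1 I))

/-- SPEEDUPW12 at the rational speed `q / r`: a period has `r` hops, where `q` and `r` are both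
doubled if `q + r` is odd. -/
noncomputable def speedupW12Rat {V : Type*} {n : ℕ} (A : TrimmedSolver V) (q r : ℕ)
    (I : Instance V n) : Timed (Run n) :=
  speedupW12 A ((q : ℝ) / r) (some (if Even (q + r) then r else 2 * r)) I

/-- SPEEDUPW12 at an arbitrary real speed `s`: all different sets of periods are tried. -/
noncomputable def speedupW12Real {V : Type*} {n : ℕ} (A : TrimmedSolver V) (s : ℝ)
    (I : Instance V n) : Timed (Run n) :=
  speedupW12 A s none I

/-- `R` is a service run at speed `s` for `I` whose profit is within a factor `ρ` of that of every
(in particular of an optimal) service run at unit speed. -/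
def IsSpeedupApprox {V : Type*} [PseudoMetricSpace V] {n : ℕ} (s ρ : ℝ) (I : Instance V n)
    (R : Run n) : Prop :=
  IsServiceRun s I R ∧ ∀ R' : Run n, IsServiceRun 1 I R' → (profit R' : ℝ) ≤ ρ * profit R

/-! A window in W_3 for period length 1/2 is longer than 3/2 and at most 2 long, so for every
starting point it contains one or two full periods of length α = 3/4. The phase with α = 3/4 alone
gives the bound: the choice j = 1 keeps the first full period of every window, and j = 2 keeps the
last one.

Parametrize the path of a unit-speed run by its own time x. A run at speed s follows this path back
and forth as a sawtooth x(z) of slope ±s whose teeth are 2α apart both in time z and in place x. For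
first periods, the tooth that climbs in the period starting at G reaches every request with G - α ≤
w < G + α and x < G + (s - 1)α (`exists_run_firstPeriod`). The time-reversed motion for last periods
reaches every request with G - α ≤ e < G + α and x > G - (s - 1)α (`exists_run_lastPeriod`).

The rest is averaging. For s = q/r cut a period into r hops and let G run through hop boundaries. If
w, x, e lie in hops W, X, E, then at least min(2r, W - X + q) first-period motions and min(2r, X - E
+ q) last-period motions reach the request: a late service loses motions of the first kind but gains
motions of the second (`coverage_le`). Over the starting points 0, 1/4, 1/2 the differences E - W
sum to at most 8r (`sum_hopIndex_sub_le`), so each request is reached by at least 2q of the 12r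
motions. Some motion therefore keeps the fraction q/(6r) = s/6 of the profit
(`exists_good_trimming`), and the trimmed-window algorithm loses a further factor γ.

Trying only residues of window endpoints loses nothing, since periods can slide to the next endpoint
and carry the run along (`exists_residue_run`). Real speeds follow from rational speeds below them.
For the step count, every period length used divides 3, so there are at most 6m residues
(`card_endpointResidues_le`). -/

/-! ### Runs from sawtooth motions -/

/-- If the services of a unit-speed run that satisfy `S` are moved to times `z` inside the windows of
`J`, and the move stretches speeds by at most the factor `s`, they form a run at speed `s`. -/
lemma exists_run_of_retimed {V : Type*} [PseudoMetricSpace V] {n : ℕ} {I J : Instance V n}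
    (hloc : ∀ i, (J i).loc = (I i).loc) {R : Run n} (hR : IsServiceRun 1 I R) {s : ℝ}
    (z : Fin n × ℝ → ℝ) (S : Fin n × ℝ → Prop) [DecidablePred S]
    (hz : ∀ p ∈ R, S p → z p ∈ Set.Ico (J p.1).opening (J p.1).closing)
    (hL : ∀ p ∈ R, ∀ p' ∈ R, S p → S p' → |p.2 - p'.2| ≤ s * |z p - z p'|) :
    ∃ R' : Run n, IsServiceRun s J R' ∧ profit R' = (R.filter S).length := by
  set Q : Run n := (R.filter S).map fun p => (p.1, z p) with hQ
  -- Backward stretches of the motion reverse the order of service, so the services are sorted by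
  -- their new times.
  have hperm := List.mergeSort_perm Q fun a b => decide (a.2 ≤ b.2)
  have hdist : ∀ p ∈ R, ∀ p' ∈ R, dist (I p.1).loc (I p'.1).loc ≤ |p.2 - p'.2| := by
    intro p hp p' hp'
    have : Std.Symm fun p p' : Fin n × ℝ => dist (I p.1).loc (I p'.1).loc ≤ |p.2 - p'.2| :=
      ⟨fun a b hab => by rw [dist_comm, abs_sub_comm]; exact hab⟩
    refine List.Pairwise.forall_of_forall
      (R := fun p p' : Fin n × ℝ => dist (I p.1).loc (I p'.1).loc ≤ |p.2 - p'.2|) ?_ ?_ hp hp'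
    · intro a _
      simp
    · refine hR.travel.imp ?_
      intro a b hab
      rw [abs_sub_comm, abs_of_nonneg (by linarith [hab.1])]
      linarith [hab.2]
  have hmem : ∀ a ∈ Q.mergeSort (fun a b => decide (a.2 ≤ b.2)),
      ∃ p ∈ R, S p ∧ a = (p.1, z p) := by
    intro a ha
    rw [hperm.mem_iff, hQ] at ha
    obtain ⟨p, hp, rfl⟩ := List.mem_map.1 ha
    obtain ⟨h1, h2⟩ := List.mem_filter.1 hp
    exact ⟨p, h1, by simpa using h2, rfl⟩
  refine ⟨Q.mergeSort fun a b => decide (a.2 ≤ b.2), ⟨?_, ?_, ?_⟩, ?_⟩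
  · rw [(hperm.map Prod.fst).nodup_iff]
    have : Q.map Prod.fst = (R.filter S).map Prod.fst := by
      rw [hQ, List.map_map]; rfl
    rw [this]
    exact hR.nodup.sublist (List.filter_sublist.map _)
  · intro a ha
    obtain ⟨p, hp, hS, rfl⟩ := hmem a ha
    exact hz p hp hS
  · have hsort : (Q.mergeSort fun a b => decide (a.2 ≤ b.2)).Pairwise
        fun a b => decide (a.2 ≤ b.2) = true := by
      apply List.pairwise_mergeSort
      · intro a b c hab hbc
        simp only [decide_eq_true_eq] at *
        exact hab.trans hbc
      · intro a b
        simpa using le_total a.2 b.2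
    refine hsort.imp_of_mem ?_
    intro a b ha hb hab
    obtain ⟨p, hp, hS, rfl⟩ := hmem a ha
    obtain ⟨p', hp', hS', rfl⟩ := hmem b hb
    have hab' : z p ≤ z p' := by simpa using hab
    refine ⟨hab', ?_⟩
    simp only [hloc]
    refine (hdist p hp p' hp').trans ((hL p hp p' hp' hS hS').trans_eq ?_)
    rw [abs_sub_comm, abs_of_nonneg (by linarith)]
  · unfold profit
    rw [hperm.length_eq, hQ, List.length_map]

/-- In a sawtooth with peaks `2α` apart in time and place, a point close to one peak lies above the
slopes of all other peaks. -/
lemma sawtooth_dominates {s α y : ℝ} (hs : 1 ≤ s) (hα : 0 < α) (h1 : -α ≤ y)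
    (h2 : s * y ≤ (s - 1) * α) (d : ℤ) :
    2 * α * d - s * |y - 2 * α * d| ≤ -(s * |y|) := by
  rcases lt_trichotomy d 0 with hd | rfl | hd
  · have hd' : (d : ℝ) ≤ -1 := by exact_mod_cast (by lia : d ≤ -1)
    have hD : 2 * α * d ≤ -(2 * α) := by nlinarith
    generalize 2 * α * (d : ℝ) = D at *
    rw [abs_of_nonneg (by linarith : 0 ≤ y - D)]
    rcases le_total 0 y with hy | hy
    · rw [abs_of_nonneg hy]; nlinarith
    · rw [abs_of_nonpos hy]; nlinarith
  · simp
  · have hd' : (1 : ℝ) ≤ d := by exact_mod_cast hd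
    have hD : 2 * α ≤ 2 * α * d := by nlinarith
    generalize 2 * α * (d : ℝ) = D at *
    have hyα : y ≤ α := by nlinarith
    rw [abs_of_nonpos (by linarith : y - D ≤ 0)]
    rcases le_total 0 y with hy | hy
    · rw [abs_of_nonneg hy]; nlinarith
    · rw [abs_of_nonpos hy]; nlinarith

/-- Points on a sawtooth of slope `s` are joined at speed at most `s`. -/
lemma sawtooth_speed {s α c h x x' z z' : ℝ} (hs : 1 ≤ s) (hα : 0 < α) {m m' : ℤ}
    (hx : x = h + 2 * α * m - s * |z - (c + 2 * α * m)|)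
    (hx' : x' = h + 2 * α * m' - s * |z' - (c + 2 * α * m')|)
    (hz : -α ≤ z - (c + 2 * α * m) ∧ s * (z - (c + 2 * α * m)) ≤ (s - 1) * α)
    (hz' : -α ≤ z' - (c + 2 * α * m') ∧ s * (z' - (c + 2 * α * m')) ≤ (s - 1) * α) :
    |x - x'| ≤ s * |z - z'| := by
  have key : ∀ {x x' z z' : ℝ} {m m' : ℤ},
      x = h + 2 * α * m - s * |z - (c + 2 * α * m)| →
      x' = h + 2 * α * m' - s * |z' - (c + 2 * α * m')| →
      (-α ≤ z' - (c + 2 * α * m') ∧ s * (z' - (c + 2 * α * m')) ≤ (s - 1) * α) →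
      x - x' ≤ s * |z - z'| := by
    intro x x' z z' m m' hx hx' hz'
    have h1 := sawtooth_dominates hs hα hz'.1 hz'.2 (m - m')
    push_cast at h1
    rw [show z' - (c + 2 * α * m') - 2 * α * (m - m') = z' - (c + 2 * α * m) by ring] at h1
    have h2 : |z' - (c + 2 * α * m)| ≤ |z - z'| + |z - (c + 2 * α * m)| := by
      rw [abs_sub_comm z z']
      exact abs_sub_le _ _ _
    have h3 := mul_le_mul_of_nonneg_left h2 (by linarith : (0 : ℝ) ≤ s)
    rw [mul_add] at h3
    have h4 : 2 * α * ((m : ℝ) - m') = 2 * α * m - 2 * α * m' := by ring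
    linarith
  rw [abs_sub_le_iff]
  refine ⟨key hx hx' hz', ?_⟩
  rw [abs_sub_comm z z']
  exact key hx' hx hz


lemma intCast_eq_of_mul_bounds {α : ℝ} (hα : 0 < α) {k l : ℤ}
    (h1 : ((l : ℝ) - 1) * α < k * α) (h2 : ((k : ℝ) - 1) * α < l * α) : k = l := by
  have h1' : (l : ℝ) - 1 < k := lt_of_mul_lt_mul_right h1 hα.le
  have h2' : (k : ℝ) - 1 < l := lt_of_mul_lt_mul_right h2 hα.le
  have h3 : l - 1 < k := by exact_mod_cast h1'
  have h4 : k - 1 < l := by exact_mod_cast h2'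
  lia

/-- Let the windows of `J` be the first full periods of the windows of `I`. The sawtooth motion that
climbs during the periods starting at `θ + 2αm` services the requests described here. -/
lemma exists_run_firstPeriod {V : Type*} [PseudoMetricSpace V] {n : ℕ} {I J : Instance V n}
    (hloc : ∀ i, (J i).loc = (I i).loc) {R : Run n} (hR : IsServiceRun 1 I R) {s α θ : ℝ}
    (hs : 1 ≤ s) (hα : 0 < α)
    (hJ : ∀ i, ∃ k : ℤ, (J i).opening = θ + k * α ∧ (J i).closing = θ + k * α + α ∧
      θ + (k - 1) * α ≤ (I i).opening ∧ (I i).opening < θ + k * α)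
    (S : Fin n × ℝ → Prop) [DecidablePred S]
    (hS : ∀ p, S p → ∃ m : ℤ, θ + 2 * α * m - α ≤ (I p.1).opening ∧
      (I p.1).opening < θ + 2 * α * m + α ∧ p.2 < θ + 2 * α * m + (s - 1) * α) :
    ∃ R' : Run n, IsServiceRun s J R' ∧ profit R' = (R.filter S).length := by
  have hs0 : 0 < s := by linarith
  have key : ∀ p, p ∈ R ∧ S p → ∃ (z : ℝ) (m : ℤ),
      z ∈ Set.Ico (J p.1).opening (J p.1).closing ∧
      p.2 = (θ + s * α - α) + 2 * α * m - s * |z - ((θ + α) + 2 * α * m)| ∧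
      -α ≤ z - ((θ + α) + 2 * α * m) ∧ s * (z - ((θ + α) + 2 * α * m)) ≤ (s - 1) * α := by
    rintro p ⟨hpR, hp⟩
    obtain ⟨m, h1, h2, h3⟩ := hS p hp
    obtain ⟨k, hk1, hk2, hk3, hk4⟩ := hJ p.1
    have hx : (I p.1).opening ≤ p.2 := (hR.inWindow p hpR).1
    -- H is the height of the peak at time θ + 2αm + α, and y below is the time between the peak and
    -- the service, before it on the climb or after it on the descent.
    set H := θ + 2 * α * m + s * α - α with hH
    have hy : 0 < (H - p.2) / s := div_pos (by linarith) hs0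
    have hsy : s * ((H - p.2) / s) = H - p.2 := by field_simp
    generalize (H - p.2) / s = y at hy hsy
    -- A window opening before the climb has the climbing period as its first full period. One
    -- opening during the climb has the next period, and is serviced on the descent; its service
    -- time is at least θ + 2αm, the height of the valley, so the descent gets that far.
    by_cases hw : (I p.1).opening < θ + 2 * α * m
    · have hk : k = 2 * m := intCast_eq_of_mul_bounds hα
        (by push_cast; linarith) (by push_cast; linarith)
      have hkα : (k : ℝ) * α = 2 * α * m := by rw [hk]; push_cast; ring
      have hyα : y ≤ α := by
        have : s * y ≤ s * α := by linarith
        exact le_of_mul_le_mul_left this hs0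
      refine ⟨θ + 2 * α * m + α - y, m, ⟨by linarith, by linarith⟩, ?_, by linarith, by nlinarith⟩
      rw [show θ + 2 * α * m + α - y - (θ + α + 2 * α * m) = -y by ring, abs_neg,
        abs_of_pos hy]
      linarith
    · have hk : k = 2 * m + 1 := intCast_eq_of_mul_bounds hα
        (by push_cast; linarith) (by push_cast; linarith)
      have hkα : (k : ℝ) * α = 2 * α * m + α := by rw [hk]; push_cast; ring
      have hyα : y < α := by
        have : s * y < s * α := by linarith
        exact lt_of_mul_lt_mul_left this hs0.le
      refine ⟨θ + 2 * α * m + α + y, m, ⟨by linarith, by linarith⟩, ?_, by linarith, ?_⟩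
      · rw [show θ + 2 * α * m + α + y - (θ + α + 2 * α * m) = y by ring, abs_of_pos hy]
        linarith
      · rw [show θ + 2 * α * m + α + y - (θ + α + 2 * α * m) = y by ring]
        linarith
  choose! z m hz using key
  refine exists_run_of_retimed hloc hR z S (fun p hp hSp => (hz p ⟨hp, hSp⟩).1) ?_
  intro p hp p' hp' hSp hSp'
  obtain ⟨-, a1, a2⟩ := hz p ⟨hp, hSp⟩
  obtain ⟨-, b1, b2⟩ := hz p' ⟨hp', hSp'⟩
  exact sawtooth_speed hs hα a1 b1 a2 b2

/-- Let the windows of `J` be the last full periods of the windows of `I`. The sawtooth motion that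
climbs during the periods ending at `θ + 2αm` services the requests described here. -/
lemma exists_run_lastPeriod {V : Type*} [PseudoMetricSpace V] {n : ℕ} {I J : Instance V n}
    (hloc : ∀ i, (J i).loc = (I i).loc) {R : Run n} (hR : IsServiceRun 1 I R) {s α θ : ℝ}
    (hs : 1 ≤ s) (hα : 0 < α)
    (hJ : ∀ i, ∃ k : ℤ, (J i).opening = θ + k * α - α ∧ (J i).closing = θ + k * α ∧
      θ + k * α ≤ (I i).closing ∧ (I i).closing < θ + (k + 1) * α)
    (S : Fin n × ℝ → Prop) [DecidablePred S]
    (hS : ∀ p, S p → ∃ m : ℤ, θ + 2 * α * m - α ≤ (I p.1).closing ∧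
      (I p.1).closing < θ + 2 * α * m + α ∧ θ + 2 * α * m - (s - 1) * α < p.2) :
    ∃ R' : Run n, IsServiceRun s J R' ∧ profit R' = (R.filter S).length := by
  have hs0 : 0 < s := by linarith
  have key : ∀ p, p ∈ R ∧ S p → ∃ (z : ℝ) (m : ℤ),
      z ∈ Set.Ico (J p.1).opening (J p.1).closing ∧
      p.2 = (θ - s * α + α) + 2 * α * m + s * |z - ((θ - α) + 2 * α * m)| ∧
      -α ≤ ((θ - α) + 2 * α * m) - z ∧ s * (((θ - α) + 2 * α * m) - z) ≤ (s - 1) * α := by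
    rintro p ⟨hpR, hp⟩
    obtain ⟨m, h1, h2, h3⟩ := hS p hp
    obtain ⟨k, hk1, hk2, hk3, hk4⟩ := hJ p.1
    have hx : p.2 < (I p.1).closing := (hR.inWindow p hpR).2
    set H := θ + 2 * α * m - s * α + α with hH
    have hy : 0 < (p.2 - H) / s := div_pos (by linarith) hs0
    have hsy : s * ((p.2 - H) / s) = p.2 - H := by field_simp
    generalize (p.2 - H) / s = y at hy hsy
    -- Here y is the distance in time from the valley at θ + 2αm - α: the service is on the climb
    -- after it or on the descent before it. The second case needs y > 0, because periods are
    -- half-open.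
    by_cases hw : θ + 2 * α * m ≤ (I p.1).closing
    · have hk : k = 2 * m := intCast_eq_of_mul_bounds hα
        (by push_cast; linarith) (by push_cast; linarith)
      have hkα : (k : ℝ) * α = 2 * α * m := by rw [hk]; push_cast; ring
      have hyα : y < α := by
        have : s * y < s * α := by linarith
        exact lt_of_mul_lt_mul_left this hs0.le
      refine ⟨θ + 2 * α * m - α + y, m, ⟨by linarith, by linarith⟩, ?_, by linarith, by nlinarith⟩
      rw [show θ + 2 * α * m - α + y - (θ - α + 2 * α * m) = y by ring, abs_of_pos hy]
      linarith
    · have hk : k = 2 * m - 1 := intCast_eq_of_mul_bounds hα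
        (by push_cast; linarith) (by push_cast; linarith)
      have hkα : (k : ℝ) * α = 2 * α * m - α := by rw [hk]; push_cast; ring
      have hyα : y < α := by
        have : s * y < s * α := by linarith
        exact lt_of_mul_lt_mul_left this hs0.le
      refine ⟨θ + 2 * α * m - α - y, m, ⟨by linarith, by linarith⟩, ?_, by linarith, ?_⟩
      · rw [show θ + 2 * α * m - α - y - (θ - α + 2 * α * m) = -y by ring, abs_neg,
          abs_of_pos hy]
        linarith
      · rw [show θ - α + 2 * α * m - (θ + 2 * α * m - α - y) = y by ring]
        linarith
  choose! z m hz using key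
  refine exists_run_of_retimed hloc hR z S (fun p hp hSp => (hz p ⟨hp, hSp⟩).1) ?_
  intro p hp p' hp' hSp hSp'
  -- Negating both time and place turns valleys into peaks and tooth m into tooth -m, so
  -- `sawtooth_speed` applies.
  have flip : ∀ p, p ∈ R ∧ S p →
      -p.2 = -(θ - s * α + α) + 2 * α * ((-m p : ℤ) : ℝ) -
        s * |-z p - (-(θ - α) + 2 * α * ((-m p : ℤ) : ℝ))| ∧
      -α ≤ -z p - (-(θ - α) + 2 * α * ((-m p : ℤ) : ℝ)) ∧
        s * (-z p - (-(θ - α) + 2 * α * ((-m p : ℤ) : ℝ))) ≤ (s - 1) * α := by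
    intro p hp
    obtain ⟨-, a1, a2⟩ := hz p hp
    have : -z p - (-(θ - α) + 2 * α * ((-m p : ℤ) : ℝ)) = ((θ - α) + 2 * α * m p) - z p := by
      push_cast; ring
    rw [this]
    refine ⟨?_, a2⟩
    rw [abs_sub_comm]
    push_cast
    linarith
  obtain ⟨a1, a2⟩ := flip p ⟨hp, hSp⟩
  obtain ⟨b1, b2⟩ := flip p' ⟨hp', hSp'⟩
  have := sawtooth_speed hs hα a1 b1 a2 b2
  rwa [neg_sub_neg, neg_sub_neg, abs_sub_comm, abs_sub_comm (z p')] at this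

/-! ### Trimming -/

namespace Timed

@[simp] lemma pure_val {β : Type} (a : β) : (pure a : Timed β).val = a := rfl

@[simp] lemma pure_steps {β : Type} (a : β) : (pure a : Timed β).steps = 0 := rfl

@[simp] lemma bind_val {β δ : Type} (x : Timed β) (f : β → Timed δ) :
    (x >>= f).val = (f x.val).val := rfl

@[simp] lemma bind_steps {β δ : Type} (x : Timed β) (f : β → Timed δ) :
    (x >>= f).steps = x.steps + (f x.val).steps := rfl

@[simp] lemma op_val {β : Type} (a : β) : (op a).val = a := rfl

@[simp] lemma op_steps {β : Type} (a : β) : (op a).steps = 1 := rfl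

end Timed

lemma choosePeriod_val (j k : ℕ) (ℓ : ℤ) :
    (choosePeriod j k ℓ).val =
      if ℓ = 1 then some 1 else if ℓ = 2 then some j else if ℓ = 3 then some k else none := by
  by_cases h1 : ℓ = 1
  · simp [choosePeriod, h1]
  · by_cases h2 : ℓ = 2
    · simp [choosePeriod, h2]
    · by_cases h3 : ℓ = 3 <;> simp [choosePeriod, h1, h2, h3]

lemma choosePeriod_steps (j k : ℕ) (ℓ : ℤ) : (choosePeriod j k ℓ).steps ≤ 3 := by
  by_cases h1 : ℓ = 1
  · simp [choosePeriod, h1]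
  · by_cases h2 : ℓ = 2
    · simp [choosePeriod, h2]
    · by_cases h3 : ℓ = 3 <;> simp [choosePeriod, h1, h2, h3]

/-- The window `[w, e)` trimmed to its period number `c`, counted from the number `f` of the period
in which it opens. -/
noncomputable def periodOf (τ α : ℝ) (f : ℤ) : Option ℕ → ℝ × ℝ
  | none => (0, 0)
  | some c => (τ + (f + c : ℤ) * α, τ + (f + c : ℤ) * α + α)

lemma trimWindow_val (τ α : ℝ) (j k : ℕ) (w e : ℝ) :
    (trimWindow τ α j k w e).val = periodOf τ α ⌊(w - τ) / α⌋
      (choosePeriod j k (⌊(e - τ) / α⌋ - (⌊(w - τ) / α⌋ + 1))).val := by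
  simp only [trimWindow, Timed.bind_val, Timed.op_val]
  cases (choosePeriod j k (⌊(e - τ) / α⌋ - (⌊(w - τ) / α⌋ + 1))).val with
  | none => rfl
  | some c =>
    simp only [Timed.bind_val, Timed.op_val, Timed.pure_val, periodOf]
    rw [show ⌊(w - τ) / α⌋ + 1 + (c : ℤ) - 1 = ⌊(w - τ) / α⌋ + c by ring]

lemma trimWindow_steps (τ α : ℝ) (j k : ℕ) (w e : ℝ) :
    (trimWindow τ α j k w e).steps ≤ 16 := by
  have := choosePeriod_steps j k (⌊(e - τ) / α⌋ - (⌊(w - τ) / α⌋ + 1))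
  simp only [trimWindow, Timed.bind_steps, Timed.op_val, Timed.op_steps]
  cases (choosePeriod j k (⌊(e - τ) / α⌋ - (⌊(w - τ) / α⌋ + 1))).val with
  | none => simp only [Timed.pure_steps]; lia
  | some c => simp only [Timed.bind_steps, Timed.op_steps, Timed.pure_steps]; lia

/-- A trimmed window is empty or a period inside the window. -/
lemma trimWindow_cases {τ α : ℝ} (hα : 0 < α) {j k : ℕ} (hj : j ∈ Set.Icc 1 2)
    (hk : k ∈ Set.Icc 1 3) (w e : ℝ) :
    (trimWindow τ α j k w e).val = (0, 0) ∨
    ∃ a : ℤ, (trimWindow τ α j k w e).val = (τ + a * α, τ + a * α + α) ∧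
      w < τ + a * α ∧ τ + a * α + α ≤ e := by
  rw [trimWindow_val, choosePeriod_val]
  have hw := Int.lt_floor_add_one ((w - τ) / α)
  have he := Int.floor_le ((e - τ) / α)
  rw [div_lt_iff₀ hα] at hw
  rw [le_div_iff₀ hα] at he
  have main : ∀ c : ℕ, 1 ≤ c → (c : ℤ) ≤ ⌊(e - τ) / α⌋ - (⌊(w - τ) / α⌋ + 1) →
      ∃ a : ℤ, periodOf τ α ⌊(w - τ) / α⌋ (some c) = (τ + a * α, τ + a * α + α) ∧
      w < τ + a * α ∧ τ + a * α + α ≤ e := by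
    intro c hc1 hc2
    refine ⟨_, rfl, ?_, ?_⟩
    · have : ((⌊(w - τ) / α⌋ : ℝ) + 1) * α ≤ (⌊(w - τ) / α⌋ + c : ℤ) * α := by
        apply mul_le_mul_of_nonneg_right _ hα.le
        push_cast
        have : (1 : ℝ) ≤ c := by exact_mod_cast hc1
        linarith
      linarith
    · have : ((⌊(w - τ) / α⌋ + c : ℤ) : ℝ) * α + α ≤ ⌊(e - τ) / α⌋ * α := by
        have h : ((⌊(w - τ) / α⌋ + c + 1 : ℤ) : ℝ) * α ≤ ⌊(e - τ) / α⌋ * α := by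
          apply mul_le_mul_of_nonneg_right _ hα.le
          exact_mod_cast (by lia)
        calc _ = ((⌊(w - τ) / α⌋ + c + 1 : ℤ) : ℝ) * α := by push_cast; ring
          _ ≤ _ := h
      linarith
  obtain ⟨hj1, hj2⟩ := hj
  obtain ⟨hk1, hk2⟩ := hk
  split_ifs with h1 h2 h3
  · exact Or.inr (main 1 le_rfl (by lia))
  · exact Or.inr (main j hj1 (by lia))
  · exact Or.inr (main k hk1 (by lia))
  · exact Or.inl rfl

/-- The instance with all windows trimmed. -/
noncomputable abbrev trimmedInstance {V : Type*} {n : ℕ} (τ α : ℝ) (j k : ℕ) (I : Instance V n) :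
    Instance V n :=
  withWindows I fun i => (trimWindow τ α j k (I i).opening (I i).closing).val

lemma trimmedTo_trimmedInstance {V : Type*} {n : ℕ} {τ α : ℝ} (hα : 0 < α) {j k : ℕ}
    (hj : j ∈ Set.Icc 1 2) (hk : k ∈ Set.Icc 1 3) (I : Instance V n) :
    TrimmedTo τ α (trimmedInstance τ α j k I) := by
  intro i
  rcases trimWindow_cases hα hj hk (τ := τ) (I i).opening (I i).closing with h | ⟨a, h, -⟩
  · left; simp [trimmedInstance, withWindows, h]
  · right
    refine ⟨a, ?_, ?_⟩ <;> simp only [trimmedInstance, withWindows, h]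
    ring

lemma IsServiceRun.of_trimmed {V : Type*} [PseudoMetricSpace V] {n : ℕ} {τ α s : ℝ} (hα : 0 < α)
    {j k : ℕ} (hj : j ∈ Set.Icc 1 2) (hk : k ∈ Set.Icc 1 3) {I : Instance V n} {R : Run n}
    (hR : IsServiceRun s (trimmedInstance τ α j k I) R) : IsServiceRun s I R := by
  refine ⟨hR.nodup, ?_, hR.travel⟩
  intro p hp
  have h0 := hR.inWindow p hp
  rcases trimWindow_cases hα hj hk (τ := τ) (I p.1).opening (I p.1).closing with h | ⟨a, h, h1, h2⟩
  · simp only [trimmedInstance, withWindows, h, Set.Ico_self] at h0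
    exact h0.elim
  · simp only [trimmedInstance, withWindows, h] at h0
    exact ⟨h1.le.trans h0.1, h0.2.trans_le h2⟩

/-- Runs may be moved in time together with the windows. -/
lemma IsServiceRun.shift {V : Type*} [PseudoMetricSpace V] {n : ℕ} {s : ℝ} {I J : Instance V n}
    {R : Run n} (hR : IsServiceRun s I R) (d : ℝ) (hloc : ∀ i, (J i).loc = (I i).loc)
    (hw : ∀ p ∈ R, p.2 + d ∈ Set.Ico (J p.1).opening (J p.1).closing) :
    ∃ R' : Run n, R' = R.map (fun p => (p.1, p.2 + d)) ∧ IsServiceRun s J R' := by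
  refine ⟨_, rfl, ?_, ?_, ?_⟩
  · rw [List.map_map]
    exact hR.nodup
  · intro a ha
    obtain ⟨p, hp, rfl⟩ := List.mem_map.1 ha
    exact hw p hp
  · rw [List.pairwise_map]
    refine hR.travel.imp ?_
    rintro a b ⟨h1, h2⟩
    refine ⟨by simpa using h1, ?_⟩
    simp only [hloc]
    rwa [add_sub_add_right_eq_sub]

lemma IsServiceRun.mono {V : Type*} [PseudoMetricSpace V] {n : ℕ} {s s' : ℝ} {I : Instance V n}
    {R : Run n} (hR : IsServiceRun s I R) (hs : s ≤ s') : IsServiceRun s' I R := by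
  refine ⟨hR.nodup, hR.inWindow, hR.travel.imp ?_⟩
  rintro a b ⟨h1, h2⟩
  exact ⟨h1, h2.trans (mul_le_mul_of_nonneg_right hs (by linarith))⟩

/-- A set of periods determines its starting point only modulo α. Sawtooth motions have a phase
modulo 2α, so two phases share each trimmed instance. -/
lemma trimWindow_add_period {τ α : ℝ} (hα : 0 < α) (j k : ℕ) (w e : ℝ) (N : ℤ) :
    (trimWindow (τ + N * α) α j k w e).val = (trimWindow τ α j k w e).val := by
  have h : ∀ x : ℝ, ⌊(x - (τ + N * α)) / α⌋ = ⌊(x - τ) / α⌋ - N := by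
    intro x
    rw [← Int.floor_sub_intCast]
    congr 1
    field_simp
    ring
  rw [trimWindow_val, trimWindow_val, h, h]
  rw [show ⌊(e - τ) / α⌋ - N - (⌊(w - τ) / α⌋ - N + 1) =
    ⌊(e - τ) / α⌋ - (⌊(w - τ) / α⌋ + 1) by ring]
  cases (choosePeriod j k (⌊(e - τ) / α⌋ - (⌊(w - τ) / α⌋ + 1))).val with
  | none => rfl
  | some c =>
    simp only [periodOf]
    push_cast
    ext <;> ring

/-- Moving the periods up to the next residue of a window endpoint moves the trimmed windows along. -/
lemma trimWindow_shift {τ α d : ℝ} (hα : 0 < α) (hd : 0 ≤ d) (j k : ℕ) {w e : ℝ}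
    (hw : d ≤ α * Int.fract ((w - τ) / α)) (he : d ≤ α * Int.fract ((e - τ) / α)) :
    (trimWindow (τ + d) α j k w e).val = (0, 0) ∧ (trimWindow τ α j k w e).val = (0, 0) ∨
    (trimWindow (τ + d) α j k w e).val =
      ((trimWindow τ α j k w e).val.1 + d, (trimWindow τ α j k w e).val.2 + d) := by
  have h : ∀ x : ℝ, d ≤ α * Int.fract ((x - τ) / α) → ⌊(x - (τ + d)) / α⌋ = ⌊(x - τ) / α⌋ := by
    intro x hx
    have h1 : d / α ≤ Int.fract ((x - τ) / α) := by rwa [div_le_iff₀' hα]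
    have h2 : 0 ≤ d / α := by positivity
    have h3 : (x - (τ + d)) / α = (x - τ) / α - d / α := by ring
    rw [Int.floor_eq_iff, h3]
    have h4 := Int.fract_lt_one ((x - τ) / α)
    unfold Int.fract at h1 h4
    constructor <;> linarith
  rw [trimWindow_val, trimWindow_val, h w hw, h e he]
  cases (choosePeriod j k (⌊(e - τ) / α⌋ - (⌊(w - τ) / α⌋ + 1))).val with
  | none => left; exact ⟨rfl, rfl⟩
  | some c =>
    right
    simp only [periodOf]
    ext <;> ring

/-- The length lies strictly between two periods and three periods, so no window vanishes and none
is in W_3. -/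
lemma floor_diff_of_length {τ w e : ℝ} (h1 : 3 / 2 < e - w) (h2 : e - w ≤ 2) :
    ⌊(e - τ) / (3 / 4)⌋ - (⌊(w - τ) / (3 / 4)⌋ + 1) = 1 ∨
      ⌊(e - τ) / (3 / 4)⌋ - (⌊(w - τ) / (3 / 4)⌋ + 1) = 2 := by
  have a1 := Int.floor_le ((w - τ) / (3 / 4))
  have a2 := Int.lt_floor_add_one ((w - τ) / (3 / 4))
  have b1 := Int.floor_le ((e - τ) / (3 / 4))
  have b2 := Int.lt_floor_add_one ((e - τ) / (3 / 4))
  generalize ⌊(e - τ) / (3 / 4)⌋ = b at *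
  generalize ⌊(w - τ) / (3 / 4)⌋ = a at *
  have c1 : a + 1 < b := by
    have : (a : ℝ) + 1 < b := by linarith
    exact_mod_cast this
  have c2 : b < a + 4 := by
    have : (b : ℝ) < a + 4 := by linarith
    exact_mod_cast this
  lia

lemma trimWindow_firstPeriod {τ w e : ℝ} (h1 : 3 / 2 < e - w) (h2 : e - w ≤ 2) :
    (trimWindow τ (3 / 4) 1 1 w e).val =
      (τ + (⌊(w - τ) / (3 / 4)⌋ + 1 : ℤ) * (3 / 4),
        τ + (⌊(w - τ) / (3 / 4)⌋ + 1 : ℤ) * (3 / 4) + 3 / 4) := by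
  rw [trimWindow_val, choosePeriod_val]
  rcases floor_diff_of_length (τ := τ) h1 h2 with h | h <;> rw [h] <;> simp [periodOf]

/-- In W_1 the only full period is also the last, so j = 2 selects the last full period in both
cases. -/
lemma trimWindow_lastPeriod {τ w e : ℝ} (h1 : 3 / 2 < e - w) (h2 : e - w ≤ 2) :
    (trimWindow τ (3 / 4) 2 1 w e).val =
      (τ + ⌊(e - τ) / (3 / 4)⌋ * (3 / 4) - 3 / 4, τ + ⌊(e - τ) / (3 / 4)⌋ * (3 / 4)) := by
  rw [trimWindow_val, choosePeriod_val]
  rcases floor_diff_of_length (τ := τ) h1 h2 with h | h <;> rw [h]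
  · have : ⌊(e - τ) / (3 / 4)⌋ = ⌊(w - τ) / (3 / 4)⌋ + 2 := by lia
    rw [this]
    simp only [periodOf, if_true]
    push_cast
    ext <;> ring
  · have : ⌊(e - τ) / (3 / 4)⌋ = ⌊(w - τ) / (3 / 4)⌋ + 3 := by lia
    rw [this]
    simp only [periodOf, if_true, OfNat.ofNat_ne_one, if_false]
    push_cast
    ext <;> ring

/-! ### Counting serviced requests -/

/-- An interval of integers no longer than `N` meets at least as many residue classes modulo `N` as
it has elements. -/
lemma sub_le_card_residues {N : ℕ} (a b : ℤ) (h : b - a ≤ N) [DecidablePred fun c : ℕ =>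
    ∃ m : ℤ, a < c + N * m ∧ c + N * m ≤ b] :
    b - a ≤ ((Finset.range N).filter fun c : ℕ =>
      ∃ m : ℤ, a < c + N * m ∧ c + N * m ≤ b).card := by
  rcases le_or_gt b a with hab | hab
  · exact (by linarith : b - a ≤ 0).trans (by positivity)
  have hN : (0 : ℤ) < N := by linarith
  have hcard : ((Finset.Ioc a b).card : ℤ) = b - a := by
    rw [Int.card_Ioc]; lia
  rw [← hcard, Nat.cast_le]
  refine Finset.card_le_card_of_injOn (fun g => (g % N).toNat) ?_ ?_
  · intro g hg
    have hg' := Finset.mem_Ioc.1 hg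
    have h1 := Int.emod_nonneg g hN.ne'
    have h2 := Int.emod_lt_of_pos g hN
    simp only [Finset.coe_filter, Set.mem_ofPred_eq, Finset.mem_range]
    refine ⟨by lia, g / N, ?_⟩
    rw [Int.toNat_of_nonneg h1, Int.emod_add_mul_ediv]
    exact hg'
  · intro g hg g' hg' hgg
    have hg1 := Finset.mem_Ioc.1 hg
    have hg2 := Finset.mem_Ioc.1 hg'
    have h1 := Int.emod_nonneg g hN.ne'
    have h2 := Int.emod_nonneg g' hN.ne'
    have h3 : g % N = g' % N := by
      have : (g % N).toNat = (g' % N).toNat := hgg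
      lia
    have h4 : (N : ℤ) ∣ g' - g := Int.ModEq.dvd (show g ≡ g' [ZMOD N] from h3)
    have h5 : g' - g = 0 := Int.eq_zero_of_abs_lt_dvd h4 (by rw [abs_lt]; constructor <;> lia)
    lia

/-- For hops of three units, the total number of hop boundaries in a window of at most `8r` units
over three starting points that are `r` units apart. -/
lemma sum_floor_div_three_le {u v : ℤ} {r : ℕ} (h : u ≤ v + 8 * r) :
    ((u / 3 - v / 3) + ((u - r) / 3 - (v - r) / 3)) + ((u - 2 * r) / 3 - (v - 2 * r) / 3) ≤
      8 * r := by
  -- If 3 does not divide r, then u, u - r, u - 2r have all residues modulo 3 and their quotients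
  -- sum to u - r - 1. If r = 3t, the three differences are equal and at most 8t each.
  lia

/-- The amount of coverage at one starting point. -/
lemma coverage_le {q r W X E F₁ F₂ : ℤ} (hq : 2 * r ≤ q) (hq' : 3 * q ≤ 7 * r)
    (hWX : W ≤ X) (hXE : X ≤ E) (hWE : 2 * r ≤ E - W) (h1 : 0 ≤ F₁)
    (h1' : W + r - max (W - r) (X - q + r) ≤ F₁) (h2' : min (E + r) (X - r + q) - (E - r) ≤ F₂) :
    2 * q + 8 * r ≤ 3 * (F₁ + F₂) + 3 * (E - W) := by
  -- The bounds on F₁ and F₂ are min(2r, W - X + q) and min(2r, X - E + q). With neither minimum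
  -- equal to 2r the right side is at least 6q, with one it is at least 6r + 3q, with both at least
  -- 12r + 6r. Each suffices for 2r ≤ q ≤ 5r.
  lia

/-- Double counting of the pairs of a motion in C and a service in L reached by it. -/
lemma mul_length_le_sum_length_filter {κ β : Type*} (C : Finset κ) (S : κ → β → Prop)
    [∀ c, DecidablePred (S c)] (B : ℕ) (L : List β)
    (h : ∀ p ∈ L, B ≤ ∑ c ∈ C, if S c p then 1 else 0) :
    B * L.length ≤ ∑ c ∈ C, (L.filter (S c)).length := by
  induction L with
  | nil => simp
  | cons p L ih =>
    have h1 := h p List.mem_cons_self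
    have h2 := ih fun x hx => h x (List.mem_cons_of_mem _ hx)
    have h3 : ∀ c, ((p :: L).filter (S c)).length =
        (if S c p then 1 else 0) + (L.filter (S c)).length := by
      intro c
      by_cases hc : S c p <;> simp [hc, add_comm]
    simp only [h3, Finset.sum_add_distrib, List.length_cons]
    lia

/-- The number of the hop that contains `x`, when hops have length `3 / (4r)` and start at `i / 4`. -/
noncomputable def hopIndex (r i : ℕ) (x : ℝ) : ℤ := (⌊4 * r * x⌋ - i * r) / 3

lemma hopIndex_bounds {r : ℕ} (hr : 0 < r) (i : ℕ) (x : ℝ) :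
    (i : ℝ) / 4 + hopIndex r i x * (3 / (4 * r)) ≤ x ∧
      x < (i : ℝ) / 4 + (hopIndex r i x + 1) * (3 / (4 * r)) := by
  have hr' : (0 : ℝ) < 4 * r := by positivity
  have h1 := Int.floor_le (4 * r * x)
  have h2 := Int.lt_floor_add_one (4 * r * x)
  have h3 : i * r + 3 * hopIndex r i x ≤ ⌊4 * r * x⌋ := by unfold hopIndex; lia
  have h4 : ⌊4 * r * x⌋ + 1 ≤ i * r + 3 * hopIndex r i x + 3 := by unfold hopIndex; lia
  have h3' : (i : ℝ) * r + 3 * hopIndex r i x ≤ ⌊4 * r * x⌋ := by exact_mod_cast h3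
  have h4' : (⌊4 * r * x⌋ : ℝ) + 1 ≤ i * r + 3 * hopIndex r i x + 3 := by exact_mod_cast h4
  constructor
  · refine le_of_mul_le_mul_left ?_ hr'
    have : 4 * (r : ℝ) * (i / 4 + hopIndex r i x * (3 / (4 * r))) =
      i * r + 3 * hopIndex r i x := by field_simp
    linarith
  · refine lt_of_mul_lt_mul_left ?_ hr'.le
    have : 4 * (r : ℝ) * (i / 4 + (hopIndex r i x + 1) * (3 / (4 * r))) =
      i * r + 3 * hopIndex r i x + 3 := by field_simp; ring
    linarith

lemma hopIndex_mono {r : ℕ} (i : ℕ) {x y : ℝ} (h : x ≤ y) :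
    hopIndex r i x ≤ hopIndex r i y := by
  have : ⌊4 * r * x⌋ ≤ ⌊4 * r * y⌋ := Int.floor_le_floor (by gcongr)
  unfold hopIndex
  lia

lemma two_mul_le_hopIndex_sub {r : ℕ} (hr : 0 < r) (i : ℕ) {w e : ℝ} (h : 3 / 2 < e - w) :
    2 * (r : ℤ) ≤ hopIndex r i e - hopIndex r i w := by
  have hr' : (0 : ℝ) < r := by exact_mod_cast hr
  have : ⌊4 * r * w⌋ + 6 * (r : ℤ) ≤ ⌊4 * r * e⌋ := by
    rw [Int.le_floor]
    push_cast
    have := Int.floor_le (4 * r * w)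
    nlinarith
  unfold hopIndex
  lia

/-- Length 2 is 8r units of 1/(4r), that is 8r/3 hops. For one starting point the count may round up
when 3 does not divide r; the sum over three has no rounding loss. -/
lemma sum_hopIndex_sub_le (r : ℕ) {w e : ℝ} (h : e - w ≤ 2) :
    ((hopIndex r 0 e - hopIndex r 0 w) + (hopIndex r 1 e - hopIndex r 1 w)) +
      (hopIndex r 2 e - hopIndex r 2 w) ≤ 8 * r := by
  have h1 : ⌊4 * r * e⌋ ≤ ⌊4 * r * w⌋ + 8 * (r : ℤ) := by
    have h3 : ⌊4 * r * w + ((8 * r : ℤ) : ℝ)⌋ = ⌊4 * r * w⌋ + 8 * (r : ℤ) :=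
      Int.floor_add_intCast _ _
    rw [← h3]
    apply Int.floor_le_floor
    push_cast
    have : (0 : ℝ) ≤ r := by positivity
    nlinarith
  have := sum_floor_div_three_le h1
  simpa [hopIndex] using this

/-- The sawtooth motion through the first full periods, with boundaries numbered by hops, reaches
`p`. -/
def ReachedFirst {V : Type*} {n : ℕ} (I : Instance V n) (q r i c : ℕ) (p : Fin n × ℝ) : Prop :=
  ∃ m : ℤ, max (hopIndex r i (I p.1).opening - r) (hopIndex r i p.2 - q + r) <
    c + ((2 * r : ℕ) : ℤ) * m ∧ c + ((2 * r : ℕ) : ℤ) * m ≤ hopIndex r i (I p.1).opening + r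

/-- The sawtooth motion through the last full periods, with boundaries numbered by hops, reaches
`p`. -/
def ReachedLast {V : Type*} {n : ℕ} (I : Instance V n) (q r i c : ℕ) (p : Fin n × ℝ) : Prop :=
  ∃ m : ℤ, hopIndex r i (I p.1).closing - r < c + ((2 * r : ℕ) : ℤ) * m ∧
    c + ((2 * r : ℕ) : ℤ) * m ≤
      min (hopIndex r i (I p.1).closing + r) (hopIndex r i p.2 - r + q)

-- With G = c + 2rm, the hop inequalities become the real ones of `exists_run_firstPeriod`, since r
-- hops make α and q hops make sα. Hops are half-open on the right, which supplies the strict bound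
-- on the service time.
open Classical in
lemma exists_run_of_reachedFirst {V : Type*} [PseudoMetricSpace V] {n : ℕ} {I : Instance V n}
    (hI : ∀ i, 3 / 2 < (I i).closing - (I i).opening ∧ (I i).closing - (I i).opening ≤ 2)
    {R : Run n} (hR : IsServiceRun 1 I R) {q r : ℕ} (hr : 0 < r) (hq : r ≤ q) (i c : ℕ) :
    ∃ R' : Run n, IsServiceRun ((q : ℝ) / r)
      (trimmedInstance ((i : ℝ) / 4 + c * (3 / (4 * r))) (3 / 4) 1 1 I) R' ∧
      profit R' = (R.filter (ReachedFirst I q r i c)).length := by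
  have hr' : (0 : ℝ) < r := by exact_mod_cast hr
  have hs : (1 : ℝ) ≤ q / r := by
    rw [le_div_iff₀ hr', one_mul]; exact_mod_cast hq
  refine exists_run_firstPeriod
    (I := I) (J := trimmedInstance ((i : ℝ) / 4 + c * (3 / (4 * r))) (3 / 4) 1 1 I) (fun _ => rfl) hR hs (by norm_num : (0 : ℝ) < 3 / 4)
    (θ := (i : ℝ) / 4 + c * (3 / (4 * r))) ?_ (ReachedFirst I q r i c) ?_
  · intro l
    set θ := (i : ℝ) / 4 + c * (3 / (4 * r))
    refine ⟨⌊((I l).opening - θ) / (3 / 4)⌋ + 1, ?_⟩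
    have h1 := Int.floor_le (((I l).opening - θ) / (3 / 4))
    have h2 := Int.lt_floor_add_one (((I l).opening - θ) / (3 / 4))
    simp only [trimmedInstance, withWindows, trimWindow_firstPeriod (hI l).1 (hI l).2]
    refine ⟨trivial, trivial, ?_, ?_⟩ <;> push_cast <;> linarith
  · rintro p ⟨m, h1, h2⟩
    obtain ⟨a1, a2⟩ := hopIndex_bounds hr i (I p.1).opening
    obtain ⟨-, b2⟩ := hopIndex_bounds hr i p.2
    obtain ⟨h1a, h1b⟩ := max_lt_iff.1 h1
    have hh : (0 : ℝ) < 3 / (4 * r) := by positivity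
    have hrh : (r : ℝ) * (3 / (4 * r)) = 3 / 4 := by field_simp
    have hqh : (q : ℝ) / r * (3 / 4) = q * (3 / (4 * r)) := by field_simp
    have hG : (i : ℝ) / 4 + c * (3 / (4 * r)) + 2 * (3 / 4) * m =
        i / 4 + ((c : ℝ) + 2 * r * m) * (3 / (4 * r)) := by
      rw [← hrh]; ring
    have c1 : (hopIndex r i (I p.1).opening : ℝ) + 1 ≤ (c : ℝ) + 2 * r * m + r := by
      exact_mod_cast (by push_cast at h1a; lia :
        hopIndex r i (I p.1).opening + 1 ≤ (c : ℤ) + 2 * r * m + r)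
    have c2 : (c : ℝ) + 2 * r * m ≤ hopIndex r i (I p.1).opening + r := by
      exact_mod_cast h2
    have c3 : (hopIndex r i p.2 : ℝ) + 1 ≤ (c : ℝ) + 2 * r * m + q - r := by
      have : hopIndex r i p.2 + 1 ≤ (c : ℤ) + 2 * r * m + q - r := by push_cast at h1b; lia
      exact_mod_cast this
    have d1 := mul_le_mul_of_nonneg_right c1 hh.le
    have d2 := mul_le_mul_of_nonneg_right c2 hh.le
    have d3 := mul_le_mul_of_nonneg_right c3 hh.le
    refine ⟨m, ?_, ?_, ?_⟩ <;> rw [hG] <;> linarith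

-- The mirror image needs a strict lower bound on the service time, but a hop contains its left end.
-- Hence `hgrid`: all hop boundaries are multiples of 1/(4r), and no service may fall on one.
open Classical in
lemma exists_run_of_reachedLast {V : Type*} [PseudoMetricSpace V] {n : ℕ} {I : Instance V n}
    (hI : ∀ i, 3 / 2 < (I i).closing - (I i).opening ∧ (I i).closing - (I i).opening ≤ 2)
    {R : Run n} (hR : IsServiceRun 1 I R) {q r : ℕ} (hr : 0 < r) (hq : r ≤ q)
    (hgrid : ∀ p ∈ R, ∀ k : ℤ, 4 * r * p.2 ≠ k) (i c : ℕ) :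
    ∃ R' : Run n, IsServiceRun ((q : ℝ) / r)
      (trimmedInstance ((i : ℝ) / 4 + c * (3 / (4 * r))) (3 / 4) 2 1 I) R' ∧
      profit R' = (R.filter (ReachedLast I q r i c)).length := by
  have hr' : (0 : ℝ) < r := by exact_mod_cast hr
  have hs : (1 : ℝ) ≤ q / r := by
    rw [le_div_iff₀ hr', one_mul]; exact_mod_cast hq
  -- Membership in R joins the predicate because `hgrid` speaks only of services in R.
  have hfil : R.filter (ReachedLast I q r i c) =
      R.filter fun p => ReachedLast I q r i c p ∧ p ∈ R := by
    apply List.filter_congr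
    intro p hp
    simp [hp]
  rw [hfil]
  refine exists_run_lastPeriod
    (I := I) (J := trimmedInstance ((i : ℝ) / 4 + c * (3 / (4 * r))) (3 / 4) 2 1 I) (fun _ => rfl) hR hs (by norm_num : (0 : ℝ) < 3 / 4)
    (θ := (i : ℝ) / 4 + c * (3 / (4 * r))) ?_ (fun p => ReachedLast I q r i c p ∧ p ∈ R) ?_
  · intro l
    set θ := (i : ℝ) / 4 + c * (3 / (4 * r))
    refine ⟨⌊((I l).closing - θ) / (3 / 4)⌋, ?_⟩
    have h1 := Int.floor_le (((I l).closing - θ) / (3 / 4))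
    have h2 := Int.lt_floor_add_one (((I l).closing - θ) / (3 / 4))
    simp only [trimmedInstance, withWindows, trimWindow_lastPeriod (hI l).1 (hI l).2]
    refine ⟨trivial, trivial, ?_, ?_⟩ <;> linarith
  · rintro p ⟨⟨m, h1, h2⟩, hpR⟩
    obtain ⟨a1, a2⟩ := hopIndex_bounds hr i (I p.1).closing
    obtain ⟨b1, -⟩ := hopIndex_bounds hr i p.2
    obtain ⟨h2a, h2b⟩ := le_min_iff.1 h2
    have hh : (0 : ℝ) < 3 / (4 * r) := by positivity
    have hrh : (r : ℝ) * (3 / (4 * r)) = 3 / 4 := by field_simp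
    have hqh : (q : ℝ) / r * (3 / 4) = q * (3 / (4 * r)) := by field_simp
    have hG : (i : ℝ) / 4 + c * (3 / (4 * r)) + 2 * (3 / 4) * m =
        i / 4 + ((c : ℝ) + 2 * r * m) * (3 / (4 * r)) := by
      rw [← hrh]; ring
    have b1' : (i : ℝ) / 4 + hopIndex r i p.2 * (3 / (4 * r)) < p.2 := by
      refine lt_of_le_of_ne b1 fun h => hgrid p hpR (i * r + 3 * hopIndex r i p.2) ?_
      have h4 : 4 * (r : ℝ) * (i / 4 + hopIndex r i p.2 * (3 / (4 * r))) =
        i * r + 3 * hopIndex r i p.2 := by field_simp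
      rw [h] at h4
      rw [h4]
      push_cast
      rfl
    have c1 : (hopIndex r i (I p.1).closing : ℝ) + 1 ≤ (c : ℝ) + 2 * r * m + r := by
      exact_mod_cast (by push_cast at h1; lia :
        hopIndex r i (I p.1).closing + 1 ≤ (c : ℤ) + 2 * r * m + r)
    have c2 : (c : ℝ) + 2 * r * m ≤ hopIndex r i (I p.1).closing + r := by
      exact_mod_cast h2a
    have c3 : (c : ℝ) + 2 * r * m ≤ hopIndex r i p.2 - r + q := by
      exact_mod_cast h2b
    have d1 := mul_le_mul_of_nonneg_right c1 hh.le
    have d2 := mul_le_mul_of_nonneg_right c2 hh.le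
    have d3 := mul_le_mul_of_nonneg_right c3 hh.le
    refine ⟨m, ?_, ?_, ?_⟩ <;> rw [hG] <;> linarith

open Classical in
/-- Some trimming with a starting point on the grid of hops loses at most the factor `6 / s`. -/
lemma exists_good_trimming {V : Type*} [PseudoMetricSpace V] {n : ℕ} {I : Instance V n}
    (hI : ∀ i, 3 / 2 < (I i).closing - (I i).opening ∧ (I i).closing - (I i).opening ≤ 2)
    {R : Run n} (hR : IsServiceRun 1 I R) {q r : ℕ} (hr : 0 < r) (hq : 2 * r ≤ q)
    (hq' : 3 * q ≤ 7 * r) (hgrid : ∀ p ∈ R, ∀ k : ℤ, 4 * r * p.2 ≠ k) :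
    ∃ i : ℕ, i < 3 ∧ ∃ c : ℕ, c < 2 * r ∧ ∃ j ∈ Set.Icc 1 2, ∃ R' : Run n, IsServiceRun ((q : ℝ) / r)
      (trimmedInstance ((i : ℝ) / 4 + c * (3 / (4 * r))) (3 / 4) j 1 I) R' ∧
      q * profit R ≤ 6 * r * profit R' := by
  -- A motion is a triple: starting point i/4, hop c modulo 2r, and first (0) or last (1) periods.
  -- There are 3 · 2r · 2 = 12r of them.
  let S : ℕ × ℕ × ℕ → Fin n × ℝ → Prop := fun κ p =>
    if κ.2.2 = 0 then ReachedFirst I q r κ.1 κ.2.1 p else ReachedLast I q r κ.1 κ.2.1 p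
  let C : Finset (ℕ × ℕ × ℕ) := Finset.range 3 ×ˢ (Finset.range (2 * r) ×ˢ Finset.range 2)
  have hcount : ∀ p ∈ R, 2 * q ≤ ∑ κ ∈ C, if S κ p then 1 else 0 := by
    intro p hp
    have hsum : (∑ κ ∈ C, if S κ p then 1 else 0) = ∑ i ∈ Finset.range 3,
        (((Finset.range (2 * r)).filter fun c => ReachedFirst I q r i c p).card +
          ((Finset.range (2 * r)).filter fun c => ReachedLast I q r i c p).card) := by
      simp only [C, S, Finset.sum_product, Finset.card_filter, ← Finset.sum_add_distrib,
        Finset.sum_range_succ (n := 1), Finset.sum_range_one, if_true, one_ne_zero, if_false]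
    have hx := hR.inWindow p hp
    have hi : ∀ i : ℕ, 2 * (q : ℤ) + 8 * r ≤
        3 * ((((Finset.range (2 * r)).filter fun c => ReachedFirst I q r i c p).card : ℤ) +
          (((Finset.range (2 * r)).filter fun c => ReachedLast I q r i c p).card : ℤ)) +
        3 * (hopIndex r i (I p.1).closing - hopIndex r i (I p.1).opening) := by
      intro i
      refine coverage_le (X := hopIndex r i p.2) (by exact_mod_cast hq) (by exact_mod_cast hq')
        (hopIndex_mono i hx.1) (hopIndex_mono i hx.2.le)
        (two_mul_le_hopIndex_sub hr i (hI p.1).1) (by positivity) ?_ ?_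
      · exact sub_le_card_residues _ _ (by push_cast; lia)
      · exact sub_le_card_residues _ _ (by push_cast; lia)
    have h0 := hi 0
    have h1 := hi 1
    have h2 := hi 2
    -- Summing the three coverage bounds gives 6q + 24r, and the differences E - W contribute at
    -- most 3 · 8r; this leaves 2q.
    have h3 := sum_hopIndex_sub_le r (hI p.1).2
    rw [hsum]
    simp only [Finset.sum_range_succ, Finset.sum_range_zero, zero_add]
    zify
    linarith
  have htotal := mul_length_le_sum_length_filter C S (2 * q) R hcount
  have hcard : C.card = 12 * r := by
    simp only [C, Finset.card_product, Finset.card_range]; ring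
  have hle : ∑ _κ ∈ C, q * R.length ≤ ∑ κ ∈ C, 6 * r * (R.filter (S κ)).length := by
    rw [Finset.sum_const, hcard, ← Finset.mul_sum, smul_eq_mul]
    calc 12 * r * (q * R.length) = 6 * r * (2 * q * R.length) := by ring
      _ ≤ _ := Nat.mul_le_mul_left _ htotal
  have hne : C.Nonempty := by
    rw [← Finset.card_pos, hcard]; lia
  obtain ⟨⟨i, c, j⟩, hκ, hgood⟩ := Finset.exists_le_of_sum_le hne hle
  simp only [C, Finset.mem_product, Finset.mem_range] at hκ
  refine ⟨i, hκ.1, c, hκ.2.1, ?_⟩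
  by_cases hj : j = 0
  · obtain ⟨R', h1, h2⟩ := exists_run_of_reachedFirst hI hR hr (by lia) i c (q := q)
    refine ⟨1, by simp, R', h1, ?_⟩
    rw [h2]
    simpa [S, hj, profit] using hgood
  · obtain ⟨R', h1, h2⟩ := exists_run_of_reachedLast hI hR hr (by lia) hgrid i c (q := q)
    refine ⟨2, by simp, R', h1, ?_⟩
    rw [h2]
    simpa [S, hj, profit] using hgood

/-- A run may be started slightly later, so that it avoids servicing at grid times. -/
lemma exists_run_off_grid {V : Type*} [PseudoMetricSpace V] {n : ℕ} {I : Instance V n} {s : ℝ}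
    {R : Run n} (hR : IsServiceRun s I R) {N : ℝ} (hN : 0 < N) :
    ∃ R' : Run n, IsServiceRun s I R' ∧ profit R' = profit R ∧
      ∀ p ∈ R', ∀ k : ℤ, N * p.2 ≠ k := by
  have h : ∀ p ∈ R, ∀ᶠ ε : ℝ in nhdsWithin 0 (Set.Ioi 0),
      p.2 + ε < (I p.1).closing ∧ p.2 + ε < (⌊N * p.2⌋ + 1) / N := by
    intro p hp
    have h1 := (hR.inWindow p hp).2
    have h2 : p.2 < (⌊N * p.2⌋ + 1) / N := by
      rw [lt_div_iff₀ hN, mul_comm]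
      exact Int.lt_floor_add_one _
    have ht : Filter.Tendsto (fun ε : ℝ => p.2 + ε) (nhdsWithin 0 (Set.Ioi 0)) (nhds p.2) := by
      have : Filter.Tendsto (fun ε : ℝ => p.2 + ε) (nhds 0) (nhds (p.2 + 0)) :=
        tendsto_const_nhds.add Filter.tendsto_id
      rw [add_zero] at this
      exact this.mono_left nhdsWithin_le_nhds
    exact (ht.eventually_lt_const h1).and (ht.eventually_lt_const h2)
  have hall : ∀ᶠ ε : ℝ in nhdsWithin 0 (Set.Ioi 0), ∀ p ∈ {p | p ∈ R},
      p.2 + ε < (I p.1).closing ∧ p.2 + ε < (⌊N * p.2⌋ + 1) / N :=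
    (Filter.eventually_all_finite (List.finite_toSet R)).2 h
  obtain ⟨ε, hε, hε0⟩ := (hall.and self_mem_nhdsWithin).exists
  have hε0 : 0 < ε := hε0
  obtain ⟨R', rfl, hR'⟩ := hR.shift (I := I) (J := I) ε (fun _ => rfl) fun p hp =>
    ⟨(hR.inWindow p hp).1.trans (by linarith), (hε p hp).1⟩
  refine ⟨_, hR', by simp [profit], ?_⟩
  intro a ha k hk
  obtain ⟨p, hp, rfl⟩ := List.mem_map.1 ha
  have h1 := (hε p hp).2
  rw [lt_div_iff₀ hN, mul_comm] at h1
  have h2 := Int.floor_le (N * p.2)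
  have h3 : (⌊N * p.2⌋ : ℝ) < k := by
    rw [← hk]
    have : 0 < N * ε := by positivity
    simp only
    linarith
  have h4 : (k : ℝ) < ⌊N * p.2⌋ + 1 := by
    rw [← hk]; exact h1
  have h5 : ⌊N * p.2⌋ < k := by exact_mod_cast h3
  have h6 : k < ⌊N * p.2⌋ + 1 := by exact_mod_cast h4
  lia

/-! ### The result of the algorithm -/

lemma better_val {n : ℕ} (R R' : Run n) :
    (better R R').val = if profit R < profit R' then R' else R := rfl

lemma retainBest_induction {n : ℕ} {P : Run n → Prop} {R : Run n} (cs : List (Timed (Run n)))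
    (hR : P R) (h : ∀ c ∈ cs, P c.val) : P (retainBest R cs).val := by
  induction cs generalizing R with
  | nil => exact hR
  | cons c cs ih =>
    simp only [retainBest, Timed.bind_val]
    apply ih
    · rw [better_val]
      split_ifs
      · exact h c List.mem_cons_self
      · exact hR
    · exact fun c' hc' => h c' (List.mem_cons_of_mem _ hc')

lemma profit_le_retainBest {n : ℕ} {R : Run n} (cs : List (Timed (Run n))) :
    profit R ≤ profit (retainBest R cs).val ∧
      ∀ c ∈ cs, profit c.val ≤ profit (retainBest R cs).val := by
  induction cs generalizing R with
  | nil => simp [retainBest]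
  | cons c cs ih =>
    simp only [retainBest, Timed.bind_val]
    obtain ⟨h1, h2⟩ := ih (R := (better R c.val).val)
    have h3 : profit R ≤ profit (better R c.val).val ∧
        profit c.val ≤ profit (better R c.val).val := by
      rw [better_val]
      split_ifs <;> constructor <;> lia
    refine ⟨h3.1.trans h1, ?_⟩
    intro c' hc'
    rcases List.mem_cons.1 hc' with rfl | hc'
    · exact h3.2.trans h1
    · exact h2 c' hc'

/-! ### Values of the loops and of the list of offsets -/

lemma mapList_val {β δ : Type} (f : β → Timed δ) (xs : List β) :
    (Timed.mapList f xs).val = xs.map fun x => (f x).val := by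
  induction xs with
  | nil => rfl
  | cons x xs ih =>
    simp only [Timed.mapList, Timed.bind_val, Timed.pure_val, List.map_cons, ih]

lemma searchList_val (x : ℝ) (l : List ℝ) : (searchList x l).val = decide (x ∈ l) := by
  induction l with
  | nil => simp [searchList]
  | cons y ys ih =>
    by_cases h : x = y
    · simp [searchList, h]
    · simp [searchList, h, ih]

lemma collect_cons_val (g : Option ℕ) (x : ℝ) (xs acc : List ℝ) (c : ℕ) :
    (collect g (x :: xs) acc c).val =
      if x ∈ acc then (collect g xs acc c).val
      else if (g.any fun b => decide (b < c + 1)) then none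
      else (collect g xs (x :: acc) (c + 1)).val := by
  simp only [collect, Timed.bind_val, searchList_val]
  by_cases h : x ∈ acc
  · simp [h]
  · simp only [h, decide_false, Bool.false_eq_true, if_false, Timed.bind_val, Timed.op_val]
    by_cases hb : (g.any fun b => decide (b < c + 1)) = true
    · rw [if_pos hb]
      exact congrArg Timed.val (if_pos hb)
    · rw [if_neg hb]
      exact congrArg Timed.val (if_neg hb)

/-- A completed collection contains all elements met. -/
lemma mem_of_collect_eq_some {g : Option ℕ} {xs acc l : List ℝ} {c : ℕ}
    (h : (collect g xs acc c).val = some l) : ∀ x, x ∈ xs ∨ x ∈ acc → x ∈ l := by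
  induction xs generalizing acc c with
  | nil =>
    simp only [collect, Timed.op_val, Option.some.injEq] at h
    subst h
    simp
  | cons y ys ih =>
    rw [collect_cons_val] at h
    intro x hx
    split_ifs at h with h1 h2
    · refine ih h x ?_
      rcases hx with hx | hx
      · rcases List.mem_cons.1 hx with rfl | hx
        · exact Or.inr h1
        · exact Or.inl hx
      · exact Or.inr hx
    · refine ih h x ?_
      rcases hx with hx | hx
      · rcases List.mem_cons.1 hx with rfl | hx
        · exact Or.inr List.mem_cons_self
        · exact Or.inl hx
      · exact Or.inr (List.mem_cons_of_mem _ hx)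

lemma collect_none_val (xs acc : List ℝ) (c : ℕ) : ∃ l, (collect none xs acc c).val = some l := by
  induction xs generalizing acc c with
  | nil => exact ⟨_, rfl⟩
  | cons x xs ih =>
    rw [collect_cons_val]
    split_ifs with h1 h2
    · exact ih _ _
    · simp at h2
    · exact ih _ _

/-- All residues of window endpoints, with repetitions. -/
noncomputable def endpointResidues {V : Type*} {n : ℕ} (τ α : ℝ) (I : Instance V n) : List ℝ :=
  ((List.finRange n).map fun i => (residue τ α (I i).opening).val) ++
    (List.finRange n).map fun i => (residue τ α (I i).closing).val

lemma offsets_val {V : Type*} {n : ℕ} (g : Option ℕ) (τ α : ℝ) (I : Instance V n) :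
    (collect g (endpointResidues τ α I) [] 0).val = some (offsets g τ α I).val ∨
    (collect g (endpointResidues τ α I) [] 0).val = none ∧ ∃ b, g = some b ∧
      (offsets g τ α I).val = (List.range b).map fun a : ℕ => (a : ℝ) * α / b := by
  have h : (offsets g τ α I).val =
      (match (collect g (endpointResidues τ α I) [] 0).val, g with
        | some l, _ => (return l : Timed (List ℝ))
        | none, none => return []
        | none, some b => Timed.mapList (fun a : ℕ => do
            let x ← Timed.op ((a : ℝ) * α)
            Timed.op (x / (b : ℝ))) (List.range b)).val := by
    simp only [offsets, Timed.bind_val, mapList_val, endpointResidues]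
  rw [h]
  cases hc : (collect g (endpointResidues τ α I) [] 0).val with
  | some l => left; rfl
  | none =>
    right
    cases g with
    | none =>
      obtain ⟨l, hl⟩ := collect_none_val (endpointResidues τ α I) [] 0
      rw [hl] at hc
      cases hc
    | some b =>
      refine ⟨rfl, b, rfl, ?_⟩
      simp only [mapList_val, Timed.bind_val, Timed.op_val]

/-- The computation for one set of periods. -/
noncomputable def trimAndSolve {V : Type*} {n : ℕ} (A : TrimmedSolver V) (s τ α : ℝ) (j k : ℕ)
    (I : Instance V n) (t : ℝ) : Timed (Run n) := do
  let τ' ← Timed.op (τ + t)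
  let W ← Timed.tabulate fun i => trimWindow τ' α j k (I i).opening (I i).closing
  A n s (withWindows I W)

lemma trimAndSolve_val {V : Type*} {n : ℕ} (A : TrimmedSolver V) (s τ α : ℝ) (j k : ℕ)
    (I : Instance V n) (t : ℝ) :
    (trimAndSolve A s τ α j k I t).val = (A n s (trimmedInstance (τ + t) α j k I)).val := rfl

lemma speedup_val {V : Type*} {n : ℕ} (A : TrimmedSolver V) (s : ℝ) (g : Option ℕ)
    (τ α : ℝ) (j k : ℕ) (I : Instance V n) :
    (speedup A s g τ α j k I).val =
      (retainBest [] ((offsets g τ α I).val.map (trimAndSolve A s τ α j k I))).val := rfl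

lemma isServiceRun_nil {V : Type*} [PseudoMetricSpace V] {n : ℕ} (s : ℝ) (I : Instance V n) :
    IsServiceRun s I [] :=
  ⟨by simp, by simp, by simp⟩

lemma isServiceRun_speedup {V : Type*} [PseudoMetricSpace V] {n : ℕ} {A : TrimmedSolver V} {γ : ℝ}
    {Γ : ℕ → ℕ} (hA : HasGuarantee A γ Γ) {s α : ℝ} (hs : 0 < s) (hα : 0 < α) {j k : ℕ}
    (hj : j ∈ Set.Icc 1 2) (hk : k ∈ Set.Icc 1 3) (g : Option ℕ) (τ : ℝ) (I : Instance V n) :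
    IsServiceRun s I (speedup A s g τ α j k I).val := by
  rw [speedup_val]
  apply retainBest_induction _ (isServiceRun_nil s I)
  intro c hc
  obtain ⟨t, -, rfl⟩ := List.mem_map.1 hc
  rw [trimAndSolve_val]
  exact ((hA n s (τ + t) α _ hs hα (trimmedTo_trimmedInstance hα hj hk I)).1).of_trimmed hα hj hk

lemma profit_le_speedup {V : Type*} [PseudoMetricSpace V] {n : ℕ} {A : TrimmedSolver V} {γ : ℝ}
    {Γ : ℕ → ℕ} (hA : HasGuarantee A γ Γ) (hγ : 0 ≤ γ) {s α : ℝ} (hs : 0 < s) (hα : 0 < α)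
    {j k : ℕ} (hj : j ∈ Set.Icc 1 2) (hk : k ∈ Set.Icc 1 3) (g : Option ℕ) (τ : ℝ)
    (I : Instance V n) {t : ℝ} (ht : t ∈ (offsets g τ α I).val) {R : Run n}
    (hR : IsServiceRun s (trimmedInstance (τ + t) α j k I) R) :
    (profit R : ℝ) ≤ γ * profit (speedup A s g τ α j k I).val := by
  have h1 := (hA n s (τ + t) α _ hs hα (trimmedTo_trimmedInstance hα hj hk I)).2.1 R hR
  refine h1.trans (mul_le_mul_of_nonneg_left ?_ hγ)
  rw [speedup_val, Nat.cast_le, ← trimAndSolve_val]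
  exact (profit_le_retainBest _).2 _ (List.mem_map_of_mem ht)

/-- Every set of periods can be replaced by one that starts at the residue of a window endpoint. -/
lemma exists_residue_run {V : Type*} [PseudoMetricSpace V] {n : ℕ} (hn : 0 < n) {s α : ℝ}
    (hα : 0 < α) {j k : ℕ} {I : Instance V n} (τ θ : ℝ) {R : Run n}
    (hR : IsServiceRun s (trimmedInstance θ α j k I) R) :
    ∃ t ∈ endpointResidues τ α I, ∃ R' : Run n,
      IsServiceRun s (trimmedInstance (τ + t) α j k I) R' ∧ profit R' = profit R := by
  let x : Fin n × Bool → ℝ := fun p => if p.2 then (I p.1).opening else (I p.1).closing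
  have : Nonempty (Fin n × Bool) := ⟨(⟨0, hn⟩, true)⟩
  obtain ⟨p₀, hp₀⟩ := Finite.exists_min fun p => α * Int.fract ((x p - θ) / α)
  -- The least distance from an endpoint back to the latest boundary not after it: moving the
  -- periods by d puts a boundary on an endpoint while none passes an endpoint.
  set d := α * Int.fract ((x p₀ - θ) / α) with hd
  have hd0 : 0 ≤ d := mul_nonneg hα.le (Int.fract_nonneg _)
  refine ⟨(residue τ α (x p₀)).val, ?_, ?_⟩
  · unfold endpointResidues
    rw [List.mem_append, List.mem_map, List.mem_map]
    rcases p₀ with ⟨i, _ | _⟩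
    · exact Or.inr ⟨i, List.mem_finRange i, rfl⟩
    · exact Or.inl ⟨i, List.mem_finRange i, rfl⟩
  · have hτ : τ + (residue τ α (x p₀)).val =
        (θ + d) + ((⌊(x p₀ - θ) / α⌋ - ⌊(x p₀ - τ) / α⌋ : ℤ) : ℝ) * α := by
      have : d = x p₀ - θ - ⌊(x p₀ - θ) / α⌋ * α := by
        rw [hd, Int.fract]
        field_simp
      rw [this]
      simp only [residue, Timed.bind_val, Timed.op_val]
      push_cast
      ring
    have hwin : ∀ i, (trimWindow (τ + (residue τ α (x p₀)).val) α j k (I i).opening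
        (I i).closing).val = (trimWindow (θ + d) α j k (I i).opening (I i).closing).val := by
      intro i
      rw [hτ, trimWindow_add_period hα]
    obtain ⟨R', rfl, hR'⟩ := hR.shift
      (J := trimmedInstance (τ + (residue τ α (x p₀)).val) α j k I) d (fun _ => rfl) (by
        intro p hp
        have h0 := hR.inWindow p hp
        simp only [trimmedInstance, withWindows, hwin] at h0 ⊢
        rcases trimWindow_shift hα hd0 j k (τ := θ) (w := (I p.1).opening)
          (e := (I p.1).closing) (hp₀ (p.1, true)) (hp₀ (p.1, false)) with ⟨-, h⟩ | h
        · rw [h] at h0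
          simp at h0
        · rw [h]
          exact ⟨by linarith [h0.1], by linarith [h0.2]⟩)
    exact ⟨_, hR', by simp [profit]⟩

/-- The sign of γ is not assumed. An instance with a run of profit 1 excludes negative γ. -/
lemma guarantee_factor_nonneg {V : Type*} [PseudoMetricSpace V] {n : ℕ} (hn : 0 < n)
    {A : TrimmedSolver V} {γ : ℝ} {Γ : ℕ → ℕ} (hA : HasGuarantee A γ Γ) (I : Instance V n) :
    0 ≤ γ := by
  let J : Instance V n := withWindows I fun _ => (0, 1)
  have hJ : TrimmedTo 0 1 J := fun i => Or.inr ⟨0, by simp [J, withWindows], by simp [J, withWindows]⟩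
  have h := (hA n 1 0 1 J one_pos one_pos hJ).2.1 [(⟨0, hn⟩, 0)]
    ⟨by simp, by simp [J, withWindows], by simp⟩
  by_contra hγ
  have h1 : γ * (profit (A n 1 J).val : ℝ) ≤ 0 :=
    mul_nonpos_of_nonpos_of_nonneg (not_le.1 hγ).le (Nat.cast_nonneg _)
  have h2 : ((profit [((⟨0, hn⟩ : Fin n), (0 : ℝ))] : ℕ) : ℝ) = 1 := by simp [profit]
  linarith

lemma isServiceRun_speedupW12 {V : Type*} [PseudoMetricSpace V] {n : ℕ} {A : TrimmedSolver V}
    {γ : ℝ} {Γ : ℕ → ℕ} (hA : HasGuarantee A γ Γ) {s : ℝ} (hs : 0 < s) (g : Option ℕ)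
    (I : Instance V n) : IsServiceRun s I (speedupW12 A s g I).val := by
  apply retainBest_induction _ (isServiceRun_nil s I)
  intro c hc
  simp only [List.mem_append, List.mem_flatMap, List.mem_map] at hc
  rcases hc with (⟨i, -, j, hj, k, hk, rfl⟩ | ⟨i, -, j, hj, rfl⟩) | ⟨i, -, rfl⟩
  · refine isServiceRun_speedup hA hs (by norm_num) ?_ ?_ _ _ _
    · simp at hj; rcases hj with rfl | rfl <;> simp
    · simp at hk; rcases hk with rfl | rfl | rfl <;> simp
  · refine isServiceRun_speedup hA hs (by norm_num) ?_ (by simp) _ _ _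
    simp at hj; rcases hj with rfl | rfl <;> simp
  · exact isServiceRun_speedup hA hs (by norm_num) (by simp) (by simp) _ _ _

/-- Only the phase with period length 3/4 is needed for the approximation; the other phases cannot
lower the retained profit. -/
lemma profit_speedup_le_speedupW12 {V : Type*} {n : ℕ} (A : TrimmedSolver V) (s : ℝ)
    (g : Option ℕ) (I : Instance V n) {i j : ℕ} (hi : i < 3) (hj : j ∈ Set.Icc 1 2) :
    profit (speedup A s g ((i : ℝ) / 4) (3 / 4) j 1 I).val ≤ profit (speedupW12 A s g I).val := by
  apply (profit_le_retainBest _).2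
  simp only [List.mem_append, List.mem_flatMap, List.mem_map, List.bind_eq_flatMap]
  refine Or.inl (Or.inr ⟨i, ⟨i, List.mem_range.2 hi, List.mem_singleton_self _⟩, j, ?_, rfl⟩)
  obtain ⟨h1, h2⟩ := hj
  interval_cases j <;> simp

/-- The approximation, for speeds at least `q / r` and periods of `r` hops or all offsets. -/
lemma profit_le_speedupW12 {V : Type*} [PseudoMetricSpace V] {n : ℕ} (hn : 0 < n)
    {A : TrimmedSolver V} {γ : ℝ} {Γ : ℕ → ℕ} (hA : HasGuarantee A γ Γ) {I : Instance V n}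
    (hI : ∀ i, 3 / 2 < (I i).closing - (I i).opening ∧ (I i).closing - (I i).opening ≤ 2)
    {q r : ℕ} (hr : 0 < r) (hq : 2 * r ≤ q) (hq' : 3 * q ≤ 7 * r) {s : ℝ} (hs : (q : ℝ) / r ≤ s)
    {g : Option ℕ} (hg : ∀ b, g = some b → b = r) {R : Run n} (hR : IsServiceRun 1 I R) :
    (q : ℝ) / r * profit R ≤ 6 * γ * profit (speedupW12 A s g I).val := by
  have hr' : (0 : ℝ) < r := by exact_mod_cast hr
  have hq0 : (0 : ℝ) < q := by exact_mod_cast (by lia : 0 < q)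
  have hs0 : 0 < s := (by positivity : 0 < (q : ℝ) / r).trans_le hs
  have hγ := guarantee_factor_nonneg hn hA I
  obtain ⟨R₁, hR₁, hp₁, hgrid⟩ := exists_run_off_grid hR (N := 4 * r) (by positivity)
  obtain ⟨i, hi, c, hc, j, hj, R₂, hR₂, hp₂⟩ := exists_good_trimming hI hR₁ hr hq hq' hgrid
  have hR₂' := hR₂.mono hs
  have hex : ∃ t ∈ (offsets g ((i : ℝ) / 4) (3 / 4) I).val, ∃ R₃ : Run n,
      IsServiceRun s (trimmedInstance ((i : ℝ) / 4 + t) (3 / 4) j 1 I) R₃ ∧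
        profit R₃ = profit R₂ := by
    rcases offsets_val g ((i : ℝ) / 4) (3 / 4) I with h | ⟨-, b, hb, h⟩
    · obtain ⟨t, ht, R₃, h1, h2⟩ := exists_residue_run hn (by norm_num) ((i : ℝ) / 4) _ hR₂'
      exact ⟨t, mem_of_collect_eq_some h t (Or.inl ht), R₃, h1, h2⟩
    · obtain rfl := hg b hb
      rw [h]
      by_cases hcb : c < b
      · refine ⟨(c : ℝ) * (3 / 4) / b, List.mem_map.2 ⟨c, List.mem_range.2 hcb, rfl⟩, R₂, ?_, rfl⟩
        convert hR₂' using 3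
        field_simp
      -- The phase c lies in the second half of the 2b hops, so the starting point is reduced by one
      -- period, which leaves the trimmed windows unchanged.
      · refine ⟨((c - b : ℕ) : ℝ) * (3 / 4) / b,
          List.mem_map.2 ⟨c - b, List.mem_range.2 (by lia), rfl⟩, R₂, ?_, rfl⟩
        convert hR₂' using 1
        have hτ : (i : ℝ) / 4 + c * (3 / (4 * b)) =
            (i : ℝ) / 4 + ((c - b : ℕ) : ℝ) * (3 / 4) / b + ((1 : ℤ) : ℝ) * (3 / 4) := by
          rw [Nat.cast_sub (by lia)]
          field_simp
          push_cast
          ring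
        unfold trimmedInstance
        rw [hτ]
        simp only [trimWindow_add_period (by norm_num : (0 : ℝ) < 3 / 4)]
  obtain ⟨t, ht, R₃, hR₃, hp₃⟩ := hex
  have h1 := profit_le_speedup hA hγ hs0 (by norm_num) hj (by simp) g ((i : ℝ) / 4) I ht hR₃
  have h2 : (profit (speedup A s g ((i : ℝ) / 4) (3 / 4) j 1 I).val : ℝ) ≤
      profit (speedupW12 A s g I).val := by
    exact_mod_cast profit_speedup_le_speedupW12 A s g I hi hj
  have h3 : (profit R₂ : ℝ) ≤ γ * profit (speedupW12 A s g I).val := by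
    rw [← hp₃]
    exact h1.trans (mul_le_mul_of_nonneg_left h2 hγ)
  have h4 : (q : ℝ) * profit R ≤ 6 * r * profit R₂ := by
    rw [← hp₁]; exact_mod_cast hp₂
  rw [div_mul_eq_mul_div, div_le_iff₀ hr']
  nlinarith

/-! ### The number of steps -/

lemma mapList_steps_le {β δ : Type} {f : β → Timed δ} {C : ℕ} (hf : ∀ x, (f x).steps ≤ C)
    (xs : List β) : (Timed.mapList f xs).steps ≤ xs.length * (C + 1) + 1 := by
  induction xs with
  | nil => simp [Timed.mapList]
  | cons x xs ih =>
    have := hf x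
    simp only [Timed.mapList, Timed.bind_steps, Timed.op_steps, Timed.pure_steps, List.length_cons]
    rw [add_mul]
    lia

lemma tabulate_steps_le {β : Type} {n C : ℕ} {f : Fin n → Timed β} (hf : ∀ i, (f i).steps ≤ C) :
    (Timed.tabulate f).steps ≤ n * (C + 1) := by
  have : (Timed.tabulate f).steps = ∑ i, ((f i).steps + 1) := rfl
  rw [this]
  calc ∑ i, ((f i).steps + 1) ≤ ∑ _i : Fin n, (C + 1) :=
        Finset.sum_le_sum fun i _ => Nat.succ_le_succ (hf i)
    _ = n * (C + 1) := by simp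

lemma searchList_steps_le (x : ℝ) (l : List ℝ) : (searchList x l).steps ≤ l.length + 1 := by
  induction l with
  | nil => simp [searchList]
  | cons y ys ih =>
    by_cases h : x = y
    · simp [searchList, h]
    · simp only [searchList, Timed.bind_steps, Timed.op_steps, Timed.op_val, h, decide_false,
        Bool.false_eq_true, if_false, List.length_cons]
      lia

lemma collect_cons_steps_le (g : Option ℕ) (x : ℝ) (xs acc : List ℝ) (c : ℕ) :
    (collect g (x :: xs) acc c).steps ≤ acc.length + 3 +
      if x ∈ acc then (collect g xs acc c).steps
      else if (g.any fun b => decide (b < c + 1)) then 0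
      else (collect g xs (x :: acc) (c + 1)).steps := by
  have h0 := searchList_steps_le x acc
  simp only [collect, Timed.bind_steps, searchList_val]
  by_cases h : x ∈ acc
  · simp only [h, decide_true, if_true]
    lia
  · simp only [h, decide_false, Bool.false_eq_true, if_false, Timed.bind_steps, Timed.op_steps]
    change (searchList x acc).steps + (1 + (1 +
      (if (g.any fun b => decide (b < c + 1)) = true then (pure none : Timed (Option (List ℝ)))
        else collect g xs (x :: acc) (c + 1)).steps)) ≤ _
    split_ifs
    · rw [Timed.pure_steps]
      lia
    · lia

/-- Collecting at most `M` different reals. -/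
lemma collect_bounds {g : Option ℕ} (S : Finset ℝ) {M : ℕ}
    (hM : ∀ c ≤ S.card, (∀ b, g = some b → c ≤ b) → c ≤ M) (xs : List ℝ) :
    ∀ (acc : List ℝ) (c : ℕ), (∀ x ∈ xs, x ∈ S) → (∀ x ∈ acc, x ∈ S) → acc.Nodup →
      acc.length = c → (∀ b, g = some b → c ≤ b) →
      (collect g xs acc c).steps ≤ xs.length * (M + 3) + 1 ∧
      (∀ l, (collect g xs acc c).val = some l → l.length ≤ M) ∧
      ((collect g xs acc c).val = none → ∀ b, g = some b → b ≤ M) := by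
  have hlen : ∀ (acc : List ℝ) (c : ℕ), (∀ x ∈ acc, x ∈ S) → acc.Nodup →
      acc.length = c → (∀ b, g = some b → c ≤ b) → c ≤ M := by
    intro acc c hacc hnd hc hb
    refine hM c ?_ hb
    rw [← hc, ← List.toFinset_card_of_nodup hnd]
    exact Finset.card_le_card fun x hx => hacc x (List.mem_toFinset.1 hx)
  induction xs with
  | nil =>
    intro acc c _ hacc hnd hc hb
    refine ⟨by simp [collect], ?_, by simp [collect]⟩
    intro l hl
    simp only [collect, Timed.op_val, Option.some.injEq] at hl
    rw [← hl, hc]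
    exact hlen acc c hacc hnd hc hb
  | cons x xs ih =>
    intro acc c hxs hacc hnd hc hb
    have hcM := hlen acc c hacc hnd hc hb
    have hsteps := collect_cons_steps_le g x xs acc c
    rw [collect_cons_val]
    have hxs' : ∀ y ∈ xs, y ∈ S := fun y hy => hxs y (List.mem_cons_of_mem _ hy)
    rw [List.length_cons, add_mul, one_mul]
    split_ifs at hsteps ⊢ with h1 h2
    · obtain ⟨a1, a2, a3⟩ := ih acc c hxs' hacc hnd hc hb
      exact ⟨by lia, a2, a3⟩
    · refine ⟨by lia, by simp, ?_⟩
      -- On giving up, c ≤ b < c + 1, so b equals c and is at most M.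
      intro _ b hgb
      have := hb b hgb
      simp only [hgb, Option.any_some, decide_eq_true_eq] at h2
      lia
    · obtain ⟨a1, a2, a3⟩ := ih (x :: acc) (c + 1) hxs'
        (List.forall_mem_cons.2 ⟨hxs x List.mem_cons_self, hacc⟩) (List.nodup_cons.2 ⟨h1, hnd⟩)
        (by simp [hc]) (by
          intro b hgb
          simp only [hgb, Option.any_some, decide_eq_true_eq] at h2
          lia)
      exact ⟨by lia, a2, a3⟩

lemma offsets_bounds {V : Type*} {n : ℕ} {g : Option ℕ} {τ α : ℝ} {I : Instance V n} {M : ℕ}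
    (hM : ∀ c ≤ (endpointResidues τ α I).toFinset.card, (∀ b, g = some b → c ≤ b) → c ≤ M) :
    (offsets g τ α I).steps ≤ 2 * (n * 6 + 1) + (2 * n * (M + 3) + 1) + (M * 3 + 1) ∧
      (offsets g τ α I).val.length ≤ M := by
  obtain ⟨h1, h2, h3⟩ := collect_bounds _ hM (endpointResidues τ α I) [] 0
    (fun x hx => List.mem_toFinset.2 hx) (by simp) (by simp) rfl (by simp)
  have hlen : (endpointResidues τ α I).length = 2 * n := by
    simp [endpointResidues]; lia
  rw [hlen] at h1
  have ho := mapList_steps_le (f := fun i => residue τ α (I i).opening) (C := 5)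
    (fun i => le_rfl) (List.finRange n)
  have hc := mapList_steps_le (f := fun i => residue τ α (I i).closing) (C := 5)
    (fun i => le_rfl) (List.finRange n)
  rw [List.length_finRange] at ho hc
  constructor
  · have h : (offsets g τ α I).steps =
        (Timed.mapList (fun i => residue τ α (I i).opening) (List.finRange n)).steps +
        ((Timed.mapList (fun i => residue τ α (I i).closing) (List.finRange n)).steps +
        ((collect g (endpointResidues τ α I) [] 0).steps +
        (match (collect g (endpointResidues τ α I) [] 0).val, g with
        | some l, _ => (return l : Timed (List ℝ))
        | none, none => return []
        | none, some b => Timed.mapList (fun a : ℕ => do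
            let x ← Timed.op ((a : ℝ) * α)
            Timed.op (x / (b : ℝ))) (List.range b)).steps)) := by
      simp only [offsets, Timed.bind_steps, mapList_val, endpointResidues]
    rw [h]
    cases hc : (collect g (endpointResidues τ α I) [] 0).val with
    | some l => simp only [Timed.pure_steps]; lia
    | none =>
      cases g with
      | none => simp only [Timed.pure_steps]; lia
      | some b =>
        have h4 := h3 hc b rfl
        have h5 := mapList_steps_le (f := fun a : ℕ => (do
            let x ← Timed.op ((a : ℝ) * α)
            Timed.op (x / (b : ℝ)) : Timed ℝ)) (C := 2) (fun a => le_rfl) (List.range b)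
        rw [List.length_range] at h5
        simp only
        lia
  · rcases offsets_val g τ α I with h | ⟨h, b, hb, h'⟩
    · exact h2 _ h
    · rw [h', List.length_map, List.length_range]
      exact h3 h b hb

/-- Comparing two runs traverses both; profits of at most n make this 2n + 1 steps. -/
lemma retainBest_steps_le {n B : ℕ} {R : Run n} (cs : List (Timed (Run n))) (hR : profit R ≤ n)
    (h : ∀ c ∈ cs, c.steps ≤ B ∧ profit c.val ≤ n) :
    (retainBest R cs).steps ≤ cs.length * (B + 2 * n + 1) + 1 := by
  induction cs generalizing R with
  | nil => simp [retainBest]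
  | cons c cs ih =>
    obtain ⟨h1, h2⟩ := h c List.mem_cons_self
    have h3 : profit (better R c.val).val ≤ n := by
      rw [better_val]; split_ifs <;> assumption
    have h4 := ih h3 fun c' hc' => h c' (List.mem_cons_of_mem _ hc')
    have h5 : (better R c.val).steps = profit R + profit c.val + 1 := rfl
    simp only [retainBest, Timed.bind_steps, h5, List.length_cons]
    rw [add_mul, one_mul]
    lia

lemma IsServiceRun.profit_le {V : Type*} [PseudoMetricSpace V] {n : ℕ} {s : ℝ} {I : Instance V n}
    {R : Run n} (hR : IsServiceRun s I R) : profit R ≤ n := by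
  have := hR.nodup.length_le_card
  rwa [List.length_map, Fintype.card_fin] at this

lemma speedup_steps_le {V : Type*} [PseudoMetricSpace V] {n : ℕ} (hn : 0 < n)
    {A : TrimmedSolver V} {γ : ℝ} {Γ : ℕ → ℕ} (hA : HasGuarantee A γ Γ) (hΓ : n ≤ Γ n) {s α : ℝ}
    (hs : 0 < s) (hα : 0 < α) {j k : ℕ} (hj : j ∈ Set.Icc 1 2) (hk : k ∈ Set.Icc 1 3)
    {g : Option ℕ} {τ : ℝ} {I : Instance V n} {M : ℕ} (hM1 : 1 ≤ M)
    (hM : ∀ c ≤ (endpointResidues τ α I).toFinset.card, (∀ b, g = some b → c ≤ b) → c ≤ M) :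
    (speedup A s g τ α j k I).steps ≤ 60 * (M * Γ n) := by
  obtain ⟨h1, h2⟩ := offsets_bounds hM
  have h3 := retainBest_steps_le (R := ([] : Run n)) (B := 1 + (n * 17 + Γ n))
    ((offsets g τ α I).val.map (trimAndSolve A s τ α j k I)) (Nat.zero_le _) (by
      intro c hc
      obtain ⟨t, -, rfl⟩ := List.mem_map.1 hc
      have hG := hA n s (τ + t) α _ hs hα (trimmedTo_trimmedInstance hα hj hk I)
      constructor
      · have hT := tabulate_steps_le (n := n) (C := 16) fun i =>
          trimWindow_steps (τ + t) α j k (I i).opening (I i).closing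
        exact Nat.add_le_add_left (Nat.add_le_add hT hG.2.2) 1
      · rw [trimAndSolve_val]
        exact hG.1.profit_le)
  have h4 : (speedup A s g τ α j k I).steps = (offsets g τ α I).steps +
      (retainBest [] ((offsets g τ α I).val.map (trimAndSolve A s τ α j k I))).steps := rfl
  rw [h4]
  rw [List.length_map] at h3
  have h5 := Nat.mul_le_mul_right (1 + (n * 17 + Γ n) + 2 * n + 1) h2
  have h6 : n * M ≤ M * Γ n := by rw [mul_comm]; exact Nat.mul_le_mul_left M hΓ
  have h7 : Γ n ≤ M * Γ n := Nat.le_mul_of_pos_left _ hM1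
  have h8 : M ≤ M * Γ n := Nat.le_mul_of_pos_right _ (hn.trans_le hΓ)
  nlinarith

lemma speedupW12_steps_le {V : Type*} [PseudoMetricSpace V] {n : ℕ} (hn : 0 < n)
    {A : TrimmedSolver V} {γ : ℝ} {Γ : ℕ → ℕ} (hA : HasGuarantee A γ Γ) (hΓ : n ≤ Γ n) {s : ℝ}
    (hs : 0 < s) {g : Option ℕ} {I : Instance V n} {M : ℕ} (hM1 : 1 ≤ M)
    (hM : ∀ τ α : ℝ, 0 < α → (∃ N : ℕ, N * α = 3) →
      ∀ c ≤ (endpointResidues τ α I).toFinset.card, (∀ b, g = some b → c ≤ b) → c ≤ M) :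
    (speedupW12 A s g I).steps ≤ 1400 * (M * Γ n) := by
  unfold speedupW12
  refine (retainBest_steps_le (B := 60 * (M * Γ n)) _ (Nat.zero_le _) ?_).trans ?_
  · intro c hc
    have key : ∀ (τ α : ℝ) (j k : ℕ), 0 < α → (∃ N : ℕ, N * α = 3) → j ∈ Set.Icc 1 2 →
        k ∈ Set.Icc 1 3 → (speedup A s g τ α j k I).steps ≤ 60 * (M * Γ n) ∧
          profit (speedup A s g τ α j k I).val ≤ n := fun τ α j k hα hN hj hk =>
      ⟨speedup_steps_le hn hA hΓ hs hα hj hk hM1 (hM τ α hα hN),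
        (isServiceRun_speedup hA hs hα hj hk g τ I).profit_le⟩
    simp only [List.mem_append, List.mem_flatMap, List.mem_map] at hc
    rcases hc with (⟨i, -, j, hj, k, hk, rfl⟩ | ⟨i, -, j, hj, rfl⟩) | ⟨i, -, rfl⟩
    · refine key _ _ _ _ (by norm_num) ⟨6, by norm_num⟩ ?_ ?_
      · simp at hj; rcases hj with rfl | rfl <;> simp
      · simp at hk; rcases hk with rfl | rfl | rfl <;> simp
    · refine key _ _ _ _ (by norm_num) ⟨4, by norm_num⟩ ?_ (by simp)
      simp at hj; rcases hj with rfl | rfl <;> simp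
    · exact key _ _ _ _ (by norm_num) ⟨3, by norm_num⟩ (by simp) (by simp)
  · have h6 : n ≤ M * Γ n := hΓ.trans (Nat.le_mul_of_pos_left _ hM1)
    have h7 : 1 ≤ M * Γ n := (Nat.one_le_iff_ne_zero.2 hn.ne').trans h6
    simp only [List.length_append, List.length_flatMap, List.length_map, List.bind_eq_flatMap,
      List.pure_def, List.length_cons, List.length_nil, List.map_const', List.sum_replicate,
      List.length_range, smul_eq_mul]
    -- There are 12 + 6 + 4 = 22 calls. With X = M · Γ n, which is at least n and at least 1, the
    -- total is at most 22(60X + 2X + X) + X = 1387X.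
    lia

/-- There are at most six times as many residues modulo a divisor `α` of `3` as modulo `1 / 2`. -/
lemma card_endpointResidues_le {V : Type*} {n : ℕ} {τ α : ℝ} (hα : 0 < α) {N : ℕ}
    (hN : N * α = 3) (I : Instance V n) :
    (endpointResidues τ α I).toFinset.card ≤ 6 * numPeriodSets I := by
  -- The fractional part of 2x and ⌊2x⌋ modulo 6 determine x modulo 3, hence modulo the divisor α of
  -- 3.
  let φ : ℝ × ℤ → ℝ := fun p => (residue τ α ((p.1 + p.2) / 2)).val
  have hφ : ∀ x : ℝ, φ (Int.fract (2 * x), ⌊2 * x⌋ % 6) = (residue τ α x).val := by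
    intro x
    have h1 : (Int.fract (2 * x) + ((⌊2 * x⌋ % 6 : ℤ) : ℝ)) / 2 =
        x - ((⌊2 * x⌋ / 6 * N : ℤ) : ℝ) * α := by
      have h2 : ((⌊2 * x⌋ % 6 : ℤ) : ℝ) + 6 * ((⌊2 * x⌋ / 6 : ℤ) : ℝ) = ⌊2 * x⌋ := by
        exact_mod_cast Int.emod_add_mul_ediv _ _
      push_cast
      rw [mul_assoc, hN, Int.fract]
      linarith
    simp only [φ]
    rw [h1]
    generalize ⌊2 * x⌋ / 6 * (N : ℤ) = k
    simp only [residue, Timed.bind_val, Timed.op_val]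
    have h3 : (x - k * α - τ) / α = (x - τ) / α - k := by field_simp; ring
    rw [h3, Int.floor_sub_intCast]
    push_cast
    ring
  let F : Finset ℝ := (Finset.univ.image fun i => Int.fract (2 * (I i).opening)) ∪
    (Finset.univ.image fun i => Int.fract (2 * (I i).closing))
  have hsub : (endpointResidues τ α I).toFinset ⊆ (F ×ˢ Finset.Ico (0 : ℤ) 6).image φ := by
    intro y hy
    rw [Finset.mem_image]
    have hmod : ∀ x : ℝ, ⌊2 * x⌋ % 6 ∈ Finset.Ico (0 : ℤ) 6 := fun x =>
      Finset.mem_Ico.2 ⟨Int.emod_nonneg _ (by norm_num), Int.emod_lt_of_pos _ (by norm_num)⟩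
    simp only [endpointResidues, List.mem_toFinset, List.mem_append, List.mem_map] at hy
    rcases hy with ⟨i, -, rfl⟩ | ⟨i, -, rfl⟩
    · exact ⟨_, Finset.mem_product.2 ⟨Finset.mem_union_left _
        (Finset.mem_image_of_mem _ (Finset.mem_univ i)), hmod _⟩, hφ _⟩
    · exact ⟨_, Finset.mem_product.2 ⟨Finset.mem_union_right _
        (Finset.mem_image_of_mem _ (Finset.mem_univ i)), hmod _⟩, hφ _⟩
  calc _ ≤ ((F ×ˢ Finset.Ico (0 : ℤ) 6).image φ).card := Finset.card_le_card hsub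
    _ ≤ (F ×ˢ Finset.Ico (0 : ℤ) 6).card := Finset.card_image_le
    _ = 6 * numPeriodSets I := by
      rw [Finset.card_product, Int.card_Ico, mul_comm]
      rfl

lemma numPeriodSets_pos {V : Type*} {n : ℕ} (hn : 0 < n) (I : Instance V n) :
    0 < numPeriodSets I :=
  Finset.card_pos.2 ⟨_, Finset.mem_union_left _
    (Finset.mem_image_of_mem _ (Finset.mem_univ (⟨0, hn⟩ : Fin n)))⟩

/-- A window in `W_3` for periods of length `1 / 2` is longer than `3 / 2`. -/
lemma InW.length {V : Type*} {τ : ℝ} {x : Request V} (h : InW 3 τ (1 / 2) x) :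
    3 / 2 < x.closing - x.opening := by
  obtain ⟨a, b, c, hab, hac, hbc, hS⟩ := Set.encard_eq_three.1 (by exact_mod_cast h)
  have key : ∀ k ∈ fullPeriods τ (1 / 2) x, ∀ l ∈ fullPeriods τ (1 / 2) x, k + 2 ≤ l →
      3 / 2 < x.closing - x.opening := by
    intro k hk l hl hkl
    have h1 := hk.1
    have h2 := hl.2
    have h3 : (k : ℝ) + 2 ≤ l := by exact_mod_cast hkl
    linarith
  have ha : a ∈ fullPeriods τ (1 / 2) x := by rw [hS]; simp
  have hb : b ∈ fullPeriods τ (1 / 2) x := by rw [hS]; simp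
  have hc : c ∈ fullPeriods τ (1 / 2) x := by rw [hS]; simp
  -- Among three different integers two differ by at least 2, and such periods k and l span at least
  -- 3/2 inside the window, which opens strictly earlier.
  have : a + 2 ≤ b ∨ a + 2 ≤ c ∨ b + 2 ≤ a ∨ b + 2 ≤ c ∨ c + 2 ≤ a ∨ c + 2 ≤ b := by lia
  rcases this with h | h | h | h | h | h
  · exact key a ha b hb h
  · exact key a ha c hc h
  · exact key b hb a ha h
  · exact key b hb c hc h
  · exact key c hc a ha h
  · exact key c hc b hb h

/-! ### The theorem for rational and for real speeds -/

theorem mainTheorem7 :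
    ∃ K : ℕ, ∀ (V : Type*) [PseudoMetricSpace V] (A : TrimmedSolver V) (γ : ℝ) (Γ : ℕ → ℕ),
      HasGuarantee A γ Γ → (∀ n, n ≤ Γ n) →
      ∀ (n : ℕ) (I : Instance V n), 0 < n →
        (∀ i, (I i).closing - (I i).opening ∈ Set.Icc (1 : ℝ) 2) →
        ∀ τ : ℝ, (∀ i, InW 3 τ (1 / 2) (I i)) →
          (∀ q r : ℕ, 0 < r → 2 ≤ (q : ℝ) / r → (q : ℝ) / r ≤ 7 / 3 →
            IsSpeedupApprox ((q : ℝ) / r) (6 * γ / ((q : ℝ) / r)) I (speedupW12Rat A q r I).val ∧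
            (speedupW12Rat A q r I).steps ≤ K * (min r (numPeriodSets I) * Γ n)) ∧
          (∀ s : ℝ, 2 ≤ s → s ≤ 7 / 3 →
            IsSpeedupApprox s (6 * γ / s) I (speedupW12Real A s I).val ∧
            (speedupW12Real A s I).steps ≤ K * (numPeriodSets I * Γ n)) := by
  refine ⟨8400, ?_⟩
  intro V _ A γ Γ hA hΓ n I hn hlen τ hW
  have hI : ∀ i, 3 / 2 < (I i).closing - (I i).opening ∧ (I i).closing - (I i).opening ≤ 2 :=
    fun i => ⟨(hW i).length, (hlen i).2⟩
  have hm := numPeriodSets_pos hn I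
  have bounds : ∀ q r : ℕ, 0 < r → 2 ≤ (q : ℝ) / r → (q : ℝ) / r ≤ 7 / 3 →
      2 * r ≤ q ∧ 3 * q ≤ 7 * r := by
    intro q r hr h1 h2
    have hr' : (0 : ℝ) < r := by exact_mod_cast hr
    rw [le_div_iff₀ hr'] at h1
    rw [div_le_iff₀ hr'] at h2
    constructor
    · exact_mod_cast h1
    · have : (3 : ℝ) * q ≤ 7 * r := by linarith
      exact_mod_cast this
  constructor
  · intro q r hr h1 h2
    obtain ⟨hq, hq'⟩ := bounds q r hr h1 h2
    have hs0 : (0 : ℝ) < (q : ℝ) / r := by linarith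
    have hr' : (0 : ℝ) < r := by exact_mod_cast hr
    refine ⟨⟨isServiceRun_speedupW12 hA hs0 _ I, ?_⟩, ?_⟩
    · intro R hR
      have key : (q : ℝ) / r * profit R ≤ 6 * γ * profit (speedupW12Rat A q r I).val := by
        unfold speedupW12Rat
        split_ifs with he
        · exact profit_le_speedupW12 hn hA hI hr hq hq' le_rfl
            (fun b hb => (Option.some.inj hb).symm) hR
        -- Doubling q and r keeps the speed and only refines the hops; the counting argument does
        -- not depend on the parity of q + r.
        · have h3 : ((2 * q : ℕ) : ℝ) / ((2 * r : ℕ) : ℝ) = (q : ℝ) / r := by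
            push_cast; exact mul_div_mul_left _ _ two_ne_zero
          have h4 := profit_le_speedupW12 hn hA hI (q := 2 * q) (r := 2 * r) (by lia) (by lia)
            (by lia) h3.le (g := some (2 * r)) (fun b hb => (Option.some.inj hb).symm) hR
          rwa [h3] at h4
      rw [div_mul_eq_mul_div, le_div_iff₀ hs0, mul_comm]
      exact key
    -- There are at most 6m residues, and the bound on offsets is r or 2r, so 6 min(r, m) covers
    -- both; this gives 8400 = 6 · 1400.
    · have h3 := speedupW12_steps_le hn hA (hΓ n) hs0 (I := I)
        (g := some (if Even (q + r) then r else 2 * r)) (M := 6 * min r (numPeriodSets I))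
        (by have := lt_min hr hm; lia) (by
          rintro τ' α hα ⟨N, hN⟩ c hc hb
          have h4 := card_endpointResidues_le (τ := τ') hα hN I
          have h5 := hb _ rfl
          split_ifs at h5 <;> lia)
      refine h3.trans (le_of_eq ?_)
      ring
  · intro s hs1 hs2
    have hs0 : 0 < s := by linarith
    refine ⟨⟨isServiceRun_speedupW12 hA hs0 _ I, ?_⟩, ?_⟩
    · intro R hR
      -- The hop argument runs at the rational speed ρ, and its run is also one at speed s. No hop
      -- grid binds the algorithm here, since all residues are tried.
      have key : ∀ ρ : ℚ, 2 ≤ (ρ : ℝ) → (ρ : ℝ) ≤ s →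
          (ρ : ℝ) * profit R ≤ 6 * γ * profit (speedupW12Real A s I).val := by
        intro ρ h1 h2
        have hρ : 0 ≤ ρ := by
          have : (0 : ℝ) ≤ ρ := by linarith
          exact_mod_cast this
        have hρq : (ρ : ℝ) = (ρ.num.toNat : ℝ) / (ρ.den : ℝ) := by
          have h3 : ((ρ.num.toNat : ℤ) : ℝ) = ρ.num := by
            rw [Int.toNat_of_nonneg (Rat.num_nonneg.2 hρ)]
          rw [← Int.cast_natCast, h3]
          exact_mod_cast (Rat.num_div_den ρ).symm
        rw [hρq] at h1 h2 ⊢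
        obtain ⟨hq, hq'⟩ := bounds _ _ ρ.den_pos h1 (h2.trans hs2)
        exact profit_le_speedupW12 hn hA hI ρ.den_pos hq hq' h2 (by simp) hR
      rw [div_mul_eq_mul_div, le_div_iff₀ hs0, mul_comm]
      rcases hs1.eq_or_lt with rfl | hs1
      · simpa using key 2 (by norm_num) (by norm_num)
      · by_contra hlt
        rw [not_le] at hlt
        rcases (Nat.zero_le (profit R)).eq_or_lt with h0 | h0
        · have := key 2 (by norm_num) (by norm_num; exact hs1.le)
          rw [← h0] at this hlt
          simp at this hlt
          linarith
        · have hp : (0 : ℝ) < profit R := by exact_mod_cast h0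
          have h1 : 6 * γ * profit (speedupW12Real A s I).val / profit R < s := by
            rwa [div_lt_iff₀ hp]
          -- If the bound failed at s, it would already fail at a rational ρ slightly below s; the
          -- maximum with 2 keeps ρ in the admissible range.
          obtain ⟨ρ, hρ1, hρ2⟩ := exists_rat_btwn (max_lt h1 hs1)
          have h2 := key ρ ((le_max_right _ _).trans hρ1.le) hρ2.le
          have h3 := (le_max_left _ _).trans_lt hρ1
          rw [div_lt_iff₀ hp] at h3
          linarith
    · have h3 := speedupW12_steps_le hn hA (hΓ n) hs0 (I := I) (g := none)
        (M := 6 * numPeriodSets I) (by lia) (by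
          rintro τ' α hα ⟨N, hN⟩ c hc -
          exact hc.trans (card_endpointResidues_le hα hN I))
      refine h3.trans (le_of_eq ?_)
      ring
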